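/- **Notation.** Fix $d$ and a smooth cut-off $\chi:\mathbb{R}^d\to\mathbb{R}$ with $\chi=1$ on $\{|\xi|\le 1\}$ and $\chi=0$ on $\{|\xi|\ge 2\}$; put $\varphi_0=\chi$ and $\varphi_n(\xi)=\chi(2^{-n}\xi)-\chi(2^{-n+1}\xi)$ for $n\ge1$, and $f_n=\mathcal{F}^{-1}(\varphi_n\hat f)$. Set $$\|f\|_{B^s_{p,q}}=\bigl\|(2^{ns}\|f_n\|_{L^p})_{n\ge0}\bigr\|_{\ell^q},\qquad \|f\|_{F^s_{p,q}}=\bigl\|\,\|(2^{ns}f_n)_{n\ge0}\|_{\ell^q}\bigr\|_{L^p}\quad(p<\infty).$$ For $s>0$ and $1\le p,q\le\infty$, $B^s_{p,q}(\mathbb{R}^d)$ is the space of $f\in L^p(\mathbb{R}^d)$ with $\|f\|_{B^s_{p,q}}<\infty$. For $\alpha>0$, $\mathscr{C}^\alpha_b(\mathbb{R}^d)$ is the set of bounded continuous functions in the closure of the Schwartz space in the norm $\|\cdot\|_{\mathscr{C}^\alpha_b}=\|\cdot\|_{B^\alpha_{\infty,\infty}}$. Further, $\Delta_hf(x)=f(x+h)-f(x)$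 and $\Delta_h^m$ is its $m$-th iterate. **Lemma (fractional integration by parts).** Let $m\ge1$ be an integer and let $\alpha,s$ be real numbers with $0<\alpha<s<m$. 1. There is a constant $C>0$, depending only on $d,m,s,\alpha$ and $\chi$, such that the following holds. Let $X$ be an $\mathbb{R}^d$-valued random variable and $K>0$, and suppose that for every $\phi\in\mathscr{C}^\alpha_b(\mathbb{R}^d)$ and every $h\in\mathbb{R}^d$ with $|h|\le1$, $$\mathbb{E}[\Delta_h^m\phi(X)]\le K|h|^s\|\phi\|_{\mathscr{C}^\alpha_b}.$$ Then $X$ has a density $f_X$ with respect to the Lebesgue measure on $\mathbb{R}^d$, $f_X\in B^{s-\alpha}_{1,\infty}(\mathbb{R}^d)$, and $\|f_X\|_{B^{s-\alpha}_{1,\infty}}\le C(1+K)$. 2. Let $1<p<\infty$ and let $q$ be the Hölder conjugate exponent of $p$. There is a constant $C>0$, depending only on $d,m,s,\alpha,p$ and $\chi$, such that the following holds. Let $f\in L^p(\mathbb{R}^d)$ and $K>0$, and suppose that for every $\phi\in C^\infty_c(\mathbb{R}^d)$ and every $h\in\mathbb{R}^d$ with $|h|\le1$, $$\Bigl|\int_{\mathbb{R}^d}\Delta_h^m\phi(x)\,f(x)\,dx\Bigr|\le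 K|h|^s\|\phi\|_{F^\alpha_{q,\infty}}.$$ Then $f\in B^{s-\alpha}_{p,\infty}(\mathbb{R}^d)$ and $\|f\|_{B^{s-\alpha}_{p,\infty}}\le C(\|f\|_{L^p}+K)$. -/

import Mathlib

open MeasureTheory ProbabilityTheory
open scoped ENNReal BoundedContinuousFunction SchwartzMap FourierTransform Convolution

noncomputable section

namespace Smoothing

/-- The Euclidean space `ℝ^d`. -/
abbrev E (d : ℕ) : Type := EuclideanSpace ℝ (Fin d)

/-- A smooth cut-off `χ` with `χ = 1` on the unit ball and `χ = 0` outside the ball of radius `2`.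
It generates the band-limited (dyadic) decomposition `symbol`. -/
structure Cutoff (d : ℕ) where
  toFun : E d → ℝ
  smooth : ContDiff ℝ (⊤ : ℕ∞) toFun
  eq_one : ∀ ξ, ‖ξ‖ ≤ 1 → toFun ξ = 1
  eq_zero : ∀ ξ, 2 ≤ ‖ξ‖ → toFun ξ = 0

instance (d : ℕ) : Nonempty (Cutoff d) := by
  let b : ContDiffBump (0 : E d) := ⟨1, 2, by norm_num, by norm_num⟩
  refine ⟨⟨b, b.contDiff, fun ξ h => ?_, fun ξ h => ?_⟩⟩
  · exact b.one_of_mem_closedBall (by simpa [b] using h)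
  · exact b.zero_of_le_dist (by simpa [b] using h)

variable {d : ℕ}

/-- The dyadic partition of unity on the frequency space: `φ₀ = χ` and
`φₙ(ξ) = χ(2⁻ⁿ ξ) - χ(2⁻⁽ⁿ⁻¹⁾ ξ)` for `n ≥ 1`. -/
def Cutoff.symbol (χ : Cutoff d) : ℕ → E d → ℝ
  | 0, ξ => χ.toFun ξ
  | n + 1, ξ => χ.toFun (((2 : ℝ) ^ (n + 1))⁻¹ • ξ) - χ.toFun (((2 : ℝ) ^ n)⁻¹ • ξ)

/-- The partial sums of the symbols are `χ(2⁻ⁿ ξ)`. -/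
theorem Cutoff.sum_symbol (χ : Cutoff d) (n : ℕ) (ξ : E d) :
    ∑ k ∈ Finset.range (n + 1), χ.symbol k ξ = χ.toFun (((2 : ℝ) ^ n)⁻¹ • ξ) := by
  induction n with
  | zero => simp [Cutoff.symbol]
  | succ n ih => rw [Finset.sum_range_succ, ih]; simp [Cutoff.symbol]

/-- The Schwartz function `𝓕⁻¹ φₙ`. -/
def Cutoff.kernel (χ : Cutoff d) (n : ℕ) : E d → ℂ :=
  𝓕⁻ (fun ξ : E d => (χ.symbol n ξ : ℂ))

/-- The Littlewood–Paley block `fₙ = 𝓕⁻¹ (φₙ 𝓕 f) = f ⋆ 𝓕⁻¹ φₙ` of a function `f`, which is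
meaningful for `f` in any `L^p`, `1 ≤ p ≤ ∞` (the only functions it is used for). -/
def Cutoff.block (χ : Cutoff d) (n : ℕ) (f : E d → ℝ) : E d → ℂ :=
  f ⋆[ContinuousLinearMap.lsmul ℝ ℝ, volume] χ.kernel n

/-- The Besov norm `‖ (2^{ns} ‖fₙ‖_{L^p})ₙ ‖_{ℓ^q}`. -/
def besovNorm (χ : Cutoff d) (s : ℝ) (p q : ℝ≥0∞) (f : E d → ℝ) : ℝ≥0∞ :=
  eLpNorm (fun n : ℕ => (2 : ℝ≥0∞) ^ ((n : ℝ) * s) * eLpNorm (χ.block n f) p volume) q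
    Measure.count

/-- The Triebel–Lizorkin norm `‖ ‖(2^{ns} fₙ(x))ₙ‖_{ℓ^q} ‖_{L^p(dx)}` (for `p < ∞`). -/
def triebelLizorkinNorm (χ : Cutoff d) (s : ℝ) (p q : ℝ≥0∞) (f : E d → ℝ) : ℝ≥0∞ :=
  eLpNorm (fun x : E d =>
    eLpNorm (fun n : ℕ => (2 : ℝ≥0∞) ^ ((n : ℝ) * s) * ‖χ.block n f x‖ₑ) q Measure.count)
    p volume

/-- Membership in the Besov space `B^s_{p,q}(ℝ^d)` for `s > 0` (where `B^s_{p,q} ⊆ L^p`). -/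
def MemBesov (χ : Cutoff d) (s : ℝ) (p q : ℝ≥0∞) (f : E d → ℝ) : Prop :=
  MemLp f p volume ∧ besovNorm χ s p q f < ∞

/-- The norm of the Zygmund space `𝒞^α_b = B^α_{∞,∞}`. -/
def zygmundNorm (χ : Cutoff d) (α : ℝ) (φ : E d → ℝ) : ℝ≥0∞ :=
  besovNorm χ α ∞ ∞ φ

/-- The separable Zygmund space `𝒞^α_b(ℝ^d)`, `α > 0`: the closure of the Schwartz space in the
norm of `B^α_{∞,∞}`. Its elements are bounded continuous functions since `α > 0`. -/
def zygmundSpace (χ : Cutoff d) (α : ℝ) : Set (E d →ᵇ ℝ) :=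
  {φ | ∀ ε : ℝ≥0∞, 0 < ε → ∃ g : 𝓢(E d, ℝ), zygmundNorm χ α (fun x => φ x - g x) < ε}

end Smoothing

end

/-!
Let `T` be integration against `f`, or against the law `μ` of `X`. Put `θ(ξ) = χ(ξ) - χ(2ξ)` and
`hⱼ = eⱼ / 4`. Dividing by `∑ₖ |e^{2πi⟨hₖ, ξ⟩} - 1|^{2m}`, which has no zero in `0 < |ξ| < 4`, one
factors `θ` exactly as `∑ⱼ (e^{2πi⟨hⱼ, ξ⟩} - 1)^m Mⱼ(ξ)` with smooth compactly supported `Mⱼ`.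
Rescaled, this writes a block at frequency `2ⁿ` of a test function `g` as a sum of `m`-th
differences with steps of order `2⁻ⁿ` of functions whose `B^α_{r,1}` norm is at most a constant
times `2^{nα} ‖g‖_{L^r}`. As this norm dominates those of `F^α_{r,∞}` and `B^α_{∞,∞}`, the
hypothesis bounds `T` on such blocks by a multiple of `2^{-n(s-α)} ‖g‖_{L^r}`, and duality turns
this into a bound of order `2^{-n(s-α)}` on the `L^p` norms of the blocks of `T`. For a law these
are bounds in `L¹`, hence summable; since the blocks of a test function sum to it, `μ` is dominated
by the measure whose density is the sum of the moduli of its blocks, so it is absolutely continuous.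
-/

noncomputable section

namespace Smoothing

open Filter Topology

variable {d : ℕ}

/-! ### Young's inequality -/

section Young

theorem lintegral_mul_rpow_le {Ω : Type*} [MeasurableSpace Ω] {μ : Measure Ω} {f k : Ω → ℝ≥0∞}
    (hf : AEMeasurable f μ) (hk : AEMeasurable k μ) {p : ℝ} (hp : 1 ≤ p) :
    (∫⁻ x, f x * k x ∂μ) ^ p ≤ (∫⁻ x, f x ^ p * k x ∂μ) * (∫⁻ x, k x ∂μ) ^ (p - 1) := by
  have hp0 : 0 < p := zero_lt_one.trans_le hp
  have hweight (g : Ω → ℝ≥0∞) (hg : AEMeasurable g μ) :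
      ∫⁻ x, g x ∂μ.withDensity k = ∫⁻ x, g x * k x ∂μ := by
    rw [lintegral_withDensity_eq_lintegral_mul₀ hk hg]
    simp only [Pi.mul_apply, mul_comm]
  have hmono := eLpNorm'_le_eLpNorm'_mul_rpow_measure_univ zero_lt_one hp
    (hf.mono_ac (withDensity_absolutelyContinuous μ k)).aestronglyMeasurable
  simp only [eLpNorm'_eq_lintegral_enorm, enorm_eq_self, ENNReal.rpow_one, div_one, hweight f hf,
    hweight _ (hf.pow_const p), withDensity_apply k MeasurableSet.univ,
    Measure.restrict_univ] at hmono
  calc (∫⁻ x, f x * k x ∂μ) ^ p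
      ≤ ((∫⁻ x, f x ^ p * k x ∂μ) ^ (1 / p) * (∫⁻ x, k x ∂μ) ^ (1 - 1 / p)) ^ p := by gcongr
    _ = (∫⁻ x, f x ^ p * k x ∂μ) * (∫⁻ x, k x ∂μ) ^ (p - 1) := by
        rw [ENNReal.mul_rpow_of_nonneg _ _ hp0.le, ← ENNReal.rpow_mul, ← ENNReal.rpow_mul,
          one_div_mul_cancel hp0.ne', ENNReal.rpow_one, sub_mul, one_div_mul_cancel hp0.ne',
          one_mul]

theorem enorm_convolution_lsmul_le {G F : Type*} [AddCommGroup G] [MeasurableSpace G]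
    {μ : Measure G} [NormedAddCommGroup F] [NormedSpace ℝ F] (f : G → ℝ) (k : G → F) (x : G) :
    ‖(f ⋆[ContinuousLinearMap.lsmul ℝ ℝ, μ] k) x‖ₑ ≤ ((‖f ·‖ₑ) ⋆ₗ[μ] (‖k ·‖ₑ)) x := by
  rw [convolution_def, lconvolution_def]
  refine (enorm_integral_le_lintegral_enorm _).trans_eq ?_
  simp only [ContinuousLinearMap.lsmul_apply, enorm_smul, neg_add_eq_sub]

variable {G : Type*} [AddCommGroup G] [MeasurableSpace G] [MeasurableAdd₂ G] [MeasurableNeg G]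
  {μ : Measure G} [SFinite μ] [μ.IsAddLeftInvariant]

theorem lintegral_lconvolution {f k : G → ℝ≥0∞} (hf : AEMeasurable f μ) (hk : AEMeasurable k μ) :
    ∫⁻ x, (f ⋆ₗ[μ] k) x ∂μ = (∫⁻ x, f x ∂μ) * ∫⁻ x, k x ∂μ := by
  simp only [lconvolution_def]
  rw [lintegral_lintegral_swap (by fun_prop), ← lintegral_mul_const'' _ hf]
  refine lintegral_congr fun y => ?_
  rw [lintegral_const_mul'' _ (by fun_prop), lintegral_add_left_eq_self]

theorem eLpNorm_lconvolution_le [μ.IsNegInvariant] {f k : G → ℝ≥0∞} (hf : AEMeasurable f μ)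
    (hk : AEMeasurable k μ) {r : ℝ≥0∞} (hr : 1 ≤ r) :
    eLpNorm (f ⋆ₗ[μ] k) r μ ≤ (∫⁻ x, k x ∂μ) * eLpNorm f r μ := by
  have hmass (x : G) : ∫⁻ y, k (-y + x) ∂μ = ∫⁻ y, k y ∂μ := by
    simp_rw [neg_add_eq_sub]
    exact lintegral_sub_left_eq_self k x
  have hkx (x : G) : AEMeasurable (fun y => k (-y + x)) μ := by
    simp_rw [neg_add_eq_sub]
    exact hk.comp_quasiMeasurePreserving (quasiMeasurePreserving_sub_left_of_right_invariant μ x)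
  rcases eq_or_ne r ∞ with rfl | hr_top
  · rw [eLpNorm_exponent_top, eLpNorm_exponent_top]
    refine essSup_le_of_ae_le _ (Eventually.of_forall fun x => ?_)
    calc (f ⋆ₗ[μ] k) x ≤ ∫⁻ y, eLpNormEssSup f μ * k (-y + x) ∂μ := by
          refine lintegral_mono_ae ?_
          filter_upwards [enorm_ae_le_eLpNormEssSup f μ] with y hy
          gcongr
          exact hy
      _ = (∫⁻ y, k y ∂μ) * eLpNormEssSup f μ := by
          rw [lintegral_const_mul'' _ (hkx x), hmass, mul_comm]
  · have hr_zero : r ≠ 0 := (zero_lt_one.trans_le hr).ne'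
    have hp : 1 ≤ r.toReal := ENNReal.toReal_mono hr_top hr
    set p := r.toReal
    have hp0 : 0 < p := zero_lt_one.trans_le hp
    rw [eLpNorm_eq_lintegral_rpow_enorm_toReal hr_zero hr_top,
      eLpNorm_eq_lintegral_rpow_enorm_toReal hr_zero hr_top]
    simp only [enorm_eq_self]
    calc (∫⁻ x, (f ⋆ₗ[μ] k) x ^ p ∂μ) ^ (1 / p)
        ≤ (∫⁻ x, ((f · ^ p) ⋆ₗ[μ] k) x * (∫⁻ y, k y ∂μ) ^ (p - 1) ∂μ) ^ (1 / p) := by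
          gcongr with x
          simpa only [lconvolution_def, hmass] using lintegral_mul_rpow_le hf (hkx x) hp
      _ = ((∫⁻ x, f x ^ p ∂μ) * (∫⁻ x, k x ∂μ) ^ p) ^ (1 / p) := by
          have hpow : (∫⁻ x, k x ∂μ) * (∫⁻ x, k x ∂μ) ^ (p - 1) = (∫⁻ x, k x ∂μ) ^ p := by
            simpa using (ENNReal.rpow_add_of_nonneg (x := ∫⁻ x, k x ∂μ) 1 (p - 1) zero_le_one
              (sub_nonneg.2 hp)).symm
          rw [lintegral_mul_const'' _ (aemeasurable_lconvolution (hf.pow_const p) hk),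
            lintegral_lconvolution (hf.pow_const p) hk, mul_assoc, hpow]
      _ = (∫⁻ x, k x ∂μ) * (∫⁻ x, f x ^ p ∂μ) ^ (1 / p) := by
          rw [ENNReal.mul_rpow_of_nonneg _ _ (by positivity), ← ENNReal.rpow_mul,
            mul_one_div_cancel hp0.ne', ENNReal.rpow_one, mul_comm]

end Young

/-! ### Fourier multipliers -/

section Fourier

variable {V : Type*} [NormedAddCommGroup V] [InnerProductSpace ℝ V]

/-- The symbol `e^{2πi⟨h, ξ⟩}` of the translation `φ ↦ φ (· + h)`. -/
def translationSymbol (h ξ : V) : ℂ := Real.fourierChar (inner ℝ h ξ)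

theorem translationSymbol_smul (c : ℝ) (h ξ : V) :
    translationSymbol (c • h) ξ = translationSymbol h (c • ξ) := by
  simp only [translationSymbol, real_inner_smul_left, real_inner_smul_right]

theorem translationSymbol_neg (h ξ : V) :
    translationSymbol (-h) ξ = (starRingEnd ℂ) (translationSymbol h ξ) := by
  rw [translationSymbol, inner_neg_left, AddChar.map_neg_eq_inv, Circle.coe_inv_eq_conj]
  rfl

theorem contDiff_translationSymbol (h : V) : ContDiff ℝ (⊤ : ℕ∞) (translationSymbol h) := by
  have hphase : ContDiff ℝ (⊤ : ℕ∞) fun ξ : V => ((2 * Real.pi * inner ℝ h ξ : ℝ) : ℂ) :=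
    Complex.ofRealCLM.contDiff.comp (contDiff_const.mul (contDiff_const.inner ℝ contDiff_id))
  exact (hphase.mul contDiff_const).cexp

theorem inner_eq_zero_of_translationSymbol_eq_one {h ξ : V} (hlt : |inner ℝ h ξ| < 1)
    (h_one : translationSymbol h ξ = 1) : inner ℝ h ξ = 0 := by
  obtain ⟨n, hn⟩ := Complex.exp_eq_one_iff.1 h_one
  have hinner : inner ℝ h ξ = (n : ℝ) := by
    have := mul_right_cancel₀ Complex.two_pi_I_ne_zero
      (show ((inner ℝ h ξ : ℝ) : ℂ) * (2 * Real.pi * Complex.I) =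
        ((n : ℝ) : ℂ) * (2 * Real.pi * Complex.I) by push_cast [← hn]; ring)
    exact_mod_cast this
  have hn_zero : n = 0 := Int.abs_lt_one_iff.1 (by exact_mod_cast hinner ▸ hlt)
  rw [hinner, hn_zero, Int.cast_zero]

/-- The difference operator `Δ_h` on Schwartz functions. -/
def schwartzDiff {F : Type*} [NormedAddCommGroup F] [NormedSpace ℝ F] (h : V) :
    𝓢(V, F) →L[ℝ] 𝓢(V, F) :=
  SchwartzMap.compSubConstCLM ℝ (-h) - ContinuousLinearMap.id ℝ _

theorem schwartzDiff_apply {F : Type*} [NormedAddCommGroup F] [NormedSpace ℝ F] (h : V)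
    (φ : 𝓢(V, F)) (x : V) : schwartzDiff h φ x = φ (x + h) - φ x := by
  simp [schwartzDiff]

theorem coe_schwartzDiff_iterate {F : Type*} [NormedAddCommGroup F] [NormedSpace ℝ F] (h : V)
    (φ : 𝓢(V, F)) (m : ℕ) : ⇑((schwartzDiff h)^[m] φ) = (fwdDiff h)^[m] φ := by
  induction m with
  | zero => rfl
  | succ m ih =>
    rw [Function.iterate_succ_apply', Function.iterate_succ_apply', ← ih]
    ext x
    rw [schwartzDiff_apply, fwdDiff]

variable [FiniteDimensional ℝ V] [MeasurableSpace V] [BorelSpace V]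

theorem fourier_schwartzDiff (h : V) (φ : 𝓢(V, ℂ)) (ξ : V) :
    𝓕 (schwartzDiff h φ) ξ = (translationSymbol h ξ - 1) * 𝓕 φ ξ := by
  have hcoe : ⇑(SchwartzMap.compSubConstCLM ℝ (-h) φ) = φ ∘ fun x => x + h := by
    funext x
    simp
  have htranslate : 𝓕 (SchwartzMap.compSubConstCLM ℝ (-h) φ) ξ = translationSymbol h ξ * 𝓕 φ ξ := by
    rw [SchwartzMap.fourier_coe, SchwartzMap.fourier_coe, hcoe]
    exact congrFun (VectorFourier.fourierIntegral_comp_add_right Real.fourierChar volume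
      (innerₗ V) φ h) ξ
  have hsub : 𝓕 (schwartzDiff h φ) = 𝓕 (SchwartzMap.compSubConstCLM ℝ (-h) φ) - 𝓕 φ :=
    map_sub (FourierTransform.fourierCLM ℝ 𝓢(V, ℂ)) _ _
  rw [hsub, sub_apply, htranslate, sub_one_mul]

theorem fourier_schwartzDiff_iterate (h : V) (φ : 𝓢(V, ℂ)) (m : ℕ) (ξ : V) :
    𝓕 ((schwartzDiff h)^[m] φ) ξ = (translationSymbol h ξ - 1) ^ m * 𝓕 φ ξ := by
  induction m with
  | zero => simp
  | succ m ih => rw [Function.iterate_succ_apply', fourier_schwartzDiff, ih, pow_succ', mul_assoc]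

section Dilation

theorem lintegral_comp_smul (μ : Measure V) [μ.IsAddHaarMeasure] (g : V → ℝ≥0∞) {c : ℝ}
    (hc : c ≠ 0) :
    ∫⁻ x, g (c • x) ∂μ = ENNReal.ofReal |(c ^ Module.finrank ℝ V)⁻¹| * ∫⁻ x, g x ∂μ := by
  rw [← smul_eq_mul, ← lintegral_smul_measure, ← Measure.map_addHaar_smul μ hc]
  exact (lintegral_map_equiv g (MeasurableEquiv.smul₀ c hc)).symm

variable {F : Type*} [NormedAddCommGroup F] [NormedSpace ℂ F]

theorem fourierInv_comp_smul (a : V → F) {c : ℝ} (hc : c ≠ 0) (x : V) :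
    𝓕⁻ (fun ξ => a (c • ξ)) x = |(c ^ Module.finrank ℝ V)⁻¹| • 𝓕⁻ a (c⁻¹ • x) := by
  rw [Real.fourierInv_eq, Real.fourierInv_eq, ← Measure.integral_comp_smul]
  simp only [real_inner_smul_left, real_inner_smul_right, inv_mul_cancel_left₀ hc]

theorem lintegral_enorm_fourierInv_comp_smul (a : V → F) {c : ℝ} (hc : c ≠ 0) :
    ∫⁻ x, ‖𝓕⁻ (fun ξ => a (c • ξ)) x‖ₑ = ∫⁻ x, ‖𝓕⁻ a x‖ₑ := by
  have hcn : c ^ Module.finrank ℝ V ≠ 0 := pow_ne_zero _ hc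
  simp_rw [fourierInv_comp_smul a hc, enorm_smul]
  rw [lintegral_const_mul' _ _ enorm_ne_top,
    lintegral_comp_smul volume (fun x => ‖𝓕⁻ a x‖ₑ) (inv_ne_zero hc), ← mul_assoc,
    Real.enorm_eq_ofReal (abs_nonneg _), ← ENNReal.ofReal_mul (abs_nonneg _), ← abs_mul, inv_pow,
    inv_inv, inv_mul_cancel₀ hcn, abs_one, ENNReal.ofReal_one, one_mul]

end Dilation

section Multiplier

theorem fourierMultiplierCLM_eq_convolution (a φ : 𝓢(V, ℂ)) :
    ⇑(SchwartzMap.fourierMultiplierCLM ℂ a φ) =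
      (φ : V → ℂ) ⋆[ContinuousLinearMap.mul ℂ ℂ, volume] (𝓕⁻ a : 𝓢(V, ℂ)) := by
  have h : SchwartzMap.fourierMultiplierCLM ℂ a φ =
      SchwartzMap.convolution (ContinuousLinearMap.mul ℂ ℂ) φ (𝓕⁻ a) := by
    refine (FourierTransform.fourierCLE ℂ 𝓢(V, ℂ)).injective ?_
    ext ξ
    simp [SchwartzMap.fourier_convolution, SchwartzMap.fourierMultiplierCLM_apply,
      SchwartzMap.smulLeftCLM_apply_apply a.hasTemperateGrowth,
      SchwartzMap.pairing_apply_apply, mul_comm]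
  funext x
  rw [h, SchwartzMap.convolution_apply]

theorem eLpNorm_fourierMultiplierCLM_le (a φ : 𝓢(V, ℂ)) {r : ℝ≥0∞} (hr : 1 ≤ r) :
    eLpNorm (SchwartzMap.fourierMultiplierCLM ℂ a φ) r volume ≤
      (∫⁻ x, ‖𝓕⁻ (a : V → ℂ) x‖ₑ) * eLpNorm φ r volume := by
  rw [← SchwartzMap.fourierInv_coe, ← eLpNorm_enorm φ]
  refine (eLpNorm_mono_enorm fun x => ?_).trans
    (eLpNorm_lconvolution_le φ.continuous.aemeasurable.enorm
      (𝓕⁻ a).continuous.aemeasurable.enorm hr)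
  rw [fourierMultiplierCLM_eq_convolution, enorm_eq_self, convolution_def, lconvolution_def]
  refine (enorm_integral_le_lintegral_enorm _).trans_eq ?_
  simp only [ContinuousLinearMap.mul_apply', enorm_mul, neg_add_eq_sub]

theorem fourier_fourierMultiplierCLM {g : V → ℂ} (hg : g.HasTemperateGrowth) (φ : 𝓢(V, ℂ)) (ξ : V) :
    𝓕 (SchwartzMap.fourierMultiplierCLM ℂ g φ) ξ = g ξ * 𝓕 φ ξ := by
  rw [SchwartzMap.fourierMultiplierCLM_apply, FourierTransform.fourier_fourierInv_eq,
    SchwartzMap.smulLeftCLM_apply_apply hg, smul_eq_mul]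

theorem ext_fourier {φ ψ : 𝓢(V, ℂ)} (h : ∀ ξ, 𝓕 φ ξ = 𝓕 ψ ξ) : φ = ψ :=
  (FourierTransform.fourierCLE ℂ 𝓢(V, ℂ)).injective (SchwartzMap.ext h)

end Multiplier

end Fourier

/-! ### The annular symbol as a sum of differences -/

section Annulus

variable {V : Type*} [NormedAddCommGroup V] [InnerProductSpace ℝ V]
  {ι : Type*} [Fintype ι]

/-- `∑ⱼ |e^{2πi⟨hⱼ, ξ⟩} - 1|^{2m}`, the common denominator of the factors in
`exists_eq_sum_translationSymbol_sub_one_pow_mul`. -/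
def diffSquareSum (h : ι → V) (m : ℕ) (ξ : V) : ℂ :=
  ∑ j, (translationSymbol (h j) ξ - 1) ^ m * (translationSymbol (-h j) ξ - 1) ^ m

theorem contDiff_translationSymbol_sub_one_pow (h : V) (m : ℕ) :
    ContDiff ℝ (⊤ : ℕ∞) fun ξ => (translationSymbol h ξ - 1) ^ m :=
  ((contDiff_translationSymbol h).sub contDiff_const).pow m

theorem contDiff_diffSquareSum (h : ι → V) (m : ℕ) :
    ContDiff ℝ (⊤ : ℕ∞) (diffSquareSum h m) :=
  ContDiff.sum fun j _ => (contDiff_translationSymbol_sub_one_pow (h j) m).mul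
    (contDiff_translationSymbol_sub_one_pow (-h j) m)

theorem diffSquareSum_eq (h : ι → V) (m : ℕ) (ξ : V) :
    diffSquareSum h m ξ = (∑ j, Complex.normSq (translationSymbol (h j) ξ - 1) ^ m : ℝ) := by
  push_cast
  refine Finset.sum_congr rfl fun j _ => ?_
  rw [← mul_pow, translationSymbol_neg, ← map_one (starRingEnd ℂ), ← map_sub, map_one,
    Complex.mul_conj]

theorem translationSymbol_eq_one_of_diffSquareSum_eq_zero {h : ι → V} {m : ℕ} {ξ : V}
    (hξ : diffSquareSum h m ξ = 0) (j : ι) : translationSymbol (h j) ξ = 1 := by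
  rw [diffSquareSum_eq, Complex.ofReal_eq_zero,
    Finset.sum_eq_zero_iff_of_nonneg fun j _ => pow_nonneg (Complex.normSq_nonneg _) m] at hξ
  exact sub_eq_zero.1 (Complex.normSq_eq_zero.1 (eq_zero_of_pow_eq_zero (hξ j (Finset.mem_univ j))))

theorem diffSquareSum_smul_basis_ne_zero (b : OrthonormalBasis ι ℝ V) (m : ℕ) {c : ℝ} (hc : c ≠ 0)
    {ξ : V} (hξ : ξ ≠ 0) (hcξ : |c| * ‖ξ‖ < 1) : diffSquareSum (fun j => c • b j) m ξ ≠ 0 := by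
  contrapose! hξ
  refine InnerProductSpace.ext_inner_left_basis b.toBasis fun j => ?_
  have hlt : |inner ℝ (c • b j) ξ| < 1 :=
    (abs_real_inner_le_norm _ _).trans_lt (by simpa [norm_smul] using hcξ)
  have hinner := inner_eq_zero_of_translationSymbol_eq_one hlt
    (translationSymbol_eq_one_of_diffSquareSum_eq_zero hξ j)
  simpa [real_inner_smul_left, hc] using hinner

theorem contDiff_div_of_ne_zero_on_tsupport {F : Type*} [NormedAddCommGroup F] [NormedSpace ℝ F]
    {θ D : F → ℂ} (hθ : ContDiff ℝ (⊤ : ℕ∞) θ) (hD : ContDiff ℝ (⊤ : ℕ∞) D)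
    (hne : ∀ ξ ∈ tsupport θ, D ξ ≠ 0) : ContDiff ℝ (⊤ : ℕ∞) fun ξ => θ ξ / D ξ := by
  refine contDiff_iff_contDiffAt.2 fun ξ => ?_
  by_cases hξ : ξ ∈ tsupport θ
  · simp only [div_eq_mul_inv]
    exact hθ.contDiffAt.mul (hD.contDiffAt.inv (hne ξ hξ))
  · refine (contDiffAt_const (c := (0 : ℂ))).congr_of_eventuallyEq ?_
    filter_upwards [notMem_tsupport_iff_eventuallyEq.1 hξ] with η hη
    rw [hη, Pi.zero_apply, zero_div]

theorem tsupport_subset_closedBall {F G : Type*} [SeminormedAddGroup F] [Zero G] {a : F → G}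
    {R : ℝ} (ha : ∀ ξ, R ≤ ‖ξ‖ → a ξ = 0) : tsupport a ⊆ Metric.closedBall 0 R :=
  closure_minimal (fun ξ hξ => mem_closedBall_zero_iff.2
    (le_of_not_ge fun h => hξ (ha ξ h))) Metric.isClosed_closedBall

theorem hasCompactSupport_of_eq_zero {F G : Type*} [SeminormedAddGroup F] [ProperSpace F] [Zero G]
    {a : F → G} {R : ℝ} (ha : ∀ ξ, R ≤ ‖ξ‖ → a ξ = 0) : HasCompactSupport a :=
  (isCompact_closedBall 0 R).of_isClosed_subset (isClosed_tsupport a)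
    (tsupport_subset_closedBall ha)

theorem exists_eq_sum_translationSymbol_sub_one_pow_mul (b : OrthonormalBasis ι ℝ V) (m : ℕ)
    {θ : V → ℂ} (hθ : ContDiff ℝ (⊤ : ℕ∞) θ) (h_zero : 0 ∉ tsupport θ) {c R : ℝ} (hc : c ≠ 0)
    (hcR : |c| * R < 1) (hR : ∀ ξ, R ≤ ‖ξ‖ → θ ξ = 0) :
    ∃ M : ι → V → ℂ, (∀ j, ContDiff ℝ (⊤ : ℕ∞) (M j)) ∧ (∀ j ξ, θ ξ = 0 → M j ξ = 0) ∧
      ∀ ξ, θ ξ = ∑ j, (translationSymbol (c • b j) ξ - 1) ^ m * M j ξ := by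
  have hne : ∀ ξ ∈ tsupport θ, diffSquareSum (fun j => c • b j) m ξ ≠ 0 := fun ξ hξ =>
    diffSquareSum_smul_basis_ne_zero b m hc (ne_of_mem_of_not_mem hξ h_zero)
      ((mul_le_mul_of_nonneg_left (mem_closedBall_zero_iff.1 (tsupport_subset_closedBall hR hξ))
        (abs_nonneg c)).trans_lt hcR)
  refine ⟨fun j ξ => θ ξ / diffSquareSum (fun j => c • b j) m ξ *
      (translationSymbol (-(c • b j)) ξ - 1) ^ m, fun j => ?_, fun j ξ hξ => ?_, fun ξ => ?_⟩
  · exact (contDiff_div_of_ne_zero_on_tsupport hθ (contDiff_diffSquareSum _ m) hne).mul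
      (contDiff_translationSymbol_sub_one_pow _ m)
  · simp only [hξ, zero_div, zero_mul]
  · simp only [mul_left_comm _ (θ ξ / _), ← Finset.mul_sum]
    by_cases hξ : θ ξ = 0
    · rw [hξ, zero_div, zero_mul]
    · exact (div_mul_cancel₀ _ (hne ξ (subset_tsupport θ hξ))).symm

end Annulus

section RealPart

variable {V : Type*} [NormedAddCommGroup V] [InnerProductSpace ℝ V]

/-- A real Schwartz function, regarded as a complex one. -/
def schwartzOfReal : 𝓢(V, ℝ) →L[ℝ] 𝓢(V, ℂ) := SchwartzMap.postcompCLM Complex.ofRealCLM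

/-- The real part of a Schwartz function. -/
def schwartzRe : 𝓢(V, ℂ) →L[ℝ] 𝓢(V, ℝ) := SchwartzMap.postcompCLM Complex.reCLM

/-- The imaginary part of a Schwartz function. -/
def schwartzIm : 𝓢(V, ℂ) →L[ℝ] 𝓢(V, ℝ) := SchwartzMap.postcompCLM Complex.imCLM

@[simp] theorem schwartzOfReal_apply (u : 𝓢(V, ℝ)) (x : V) : schwartzOfReal u x = u x := rfl

@[simp] theorem schwartzRe_apply (φ : 𝓢(V, ℂ)) (x : V) : schwartzRe φ x = (φ x).re := rfl

@[simp] theorem schwartzIm_apply (φ : 𝓢(V, ℂ)) (x : V) : schwartzIm φ x = (φ x).im := rfl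

theorem schwartzOfReal_re_add_I_smul_im (φ : 𝓢(V, ℂ)) :
    schwartzOfReal (schwartzRe φ) + Complex.I • schwartzOfReal (schwartzIm φ) = φ := by
  ext x
  simpa [mul_comm] using Complex.re_add_im (φ x)

theorem schwartzDiff_iterate_schwartzOfReal (h : V) (m : ℕ) (u : 𝓢(V, ℝ)) :
    (schwartzDiff h)^[m] (schwartzOfReal u) = schwartzOfReal ((schwartzDiff h)^[m] u) := by
  have hcomm : Function.Semiconj (schwartzOfReal : 𝓢(V, ℝ) → 𝓢(V, ℂ)) (schwartzDiff h)
      (schwartzDiff h) := fun u => by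
    ext x
    simp [schwartzDiff_apply]
  exact (hcomm.iterate_right m u).symm

theorem schwartzDiff_iterate_smul (h : V) (m : ℕ) (c : ℂ) (φ : 𝓢(V, ℂ)) :
    (schwartzDiff h)^[m] (c • φ) = c • (schwartzDiff h)^[m] φ := by
  have hcomm : Function.Semiconj (c • · : 𝓢(V, ℂ) → 𝓢(V, ℂ)) (schwartzDiff h)
      (schwartzDiff h) := fun φ => by
    ext x
    simp [schwartzDiff_apply, mul_sub]
  exact (hcomm.iterate_right m φ).symm

theorem schwartzDiff_iterate_eq_re_add_I_smul_im (h : V) (m : ℕ) (φ : 𝓢(V, ℂ)) :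
    (schwartzDiff h)^[m] φ = schwartzOfReal ((schwartzDiff h)^[m] (schwartzRe φ)) +
      Complex.I • schwartzOfReal ((schwartzDiff h)^[m] (schwartzIm φ)) := by
  conv_lhs => rw [← schwartzOfReal_re_add_I_smul_im φ]
  rw [iterate_map_add, schwartzDiff_iterate_smul, schwartzDiff_iterate_schwartzOfReal,
    schwartzDiff_iterate_schwartzOfReal]

variable [FiniteDimensional ℝ V] [MeasurableSpace V] [BorelSpace V]

theorem fourier_conj (f : V → ℂ) (ξ : V) :
    𝓕 (fun x => (starRingEnd ℂ) (f x)) ξ = (starRingEnd ℂ) (𝓕 f (-ξ)) := by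
  rw [Real.fourier_eq', Real.fourier_eq', ← integral_conj]
  refine integral_congr_ae (Eventually.of_forall fun x => ?_)
  simp [← Complex.exp_conj, Complex.conj_ofNat]

/-- The frequencies of `φ` lie in the open ball of radius `R`. -/
def IsBandLimited (R : ℝ) (φ : 𝓢(V, ℂ)) : Prop := ∀ ξ, R ≤ ‖ξ‖ → 𝓕 φ ξ = 0

variable {R : ℝ} {φ : 𝓢(V, ℂ)}

theorem IsBandLimited.schwartzRe (hφ : IsBandLimited R φ) :
    IsBandLimited R (schwartzOfReal (schwartzRe φ)) := fun ξ hξ => by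
  set ψ : 𝓢(V, ℂ) := SchwartzMap.postcompCLM (Complex.conjCLE : ℂ →L[ℝ] ℂ) φ
  have hre : schwartzOfReal (Smoothing.schwartzRe φ) = (1 / 2 : ℂ) • (φ + ψ) := by
    ext x
    simpa [ψ, div_eq_inv_mul, mul_add] using Complex.re_eq_add_conj (φ x)
  have hψ : 𝓕 ψ ξ = 0 := by
    refine (congrFun (SchwartzMap.fourier_coe ψ) ξ).trans ((fourier_conj φ ξ).trans ?_)
    rw [← SchwartzMap.fourier_coe, hφ (-ξ) (by rwa [norm_neg]), map_zero]
  rw [hre, FourierTransform.fourier_smul, FourierTransform.fourier_add, smul_apply, add_apply,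
    hφ ξ hξ, hψ, add_zero, smul_zero]

theorem IsBandLimited.schwartzIm (hφ : IsBandLimited R φ) :
    IsBandLimited R (schwartzOfReal (schwartzIm φ)) := by
  have him : Smoothing.schwartzIm φ = Smoothing.schwartzRe (-Complex.I • φ) := by
    ext x
    simp
  rw [him]
  refine IsBandLimited.schwartzRe fun ξ hξ => ?_
  rw [FourierTransform.fourier_smul, smul_apply, hφ ξ hξ, smul_zero]

end RealPart

/-! ### Littlewood–Paley blocks -/

namespace Cutoff

/-- The annular profile `χ(ξ) - χ(2ξ)`, of which all the symbols `φₙ`, `n ≥ 1`, are dilations. -/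
def profile (χ : Cutoff d) (ξ : E d) : ℂ := (χ.toFun ξ - χ.toFun ((2 : ℝ) • ξ) : ℝ)

theorem contDiff_profile (χ : Cutoff d) : ContDiff ℝ (⊤ : ℕ∞) χ.profile :=
  Complex.ofRealCLM.contDiff.comp (χ.smooth.sub (χ.smooth.comp (contDiff_const_smul 2)))

theorem profile_eq_zero_of_norm_le (χ : Cutoff d) {ξ : E d} (hξ : ‖ξ‖ ≤ 1 / 2) :
    χ.profile ξ = 0 := by
  have h2ξ : ‖(2 : ℝ) • ξ‖ ≤ 1 := by
    rw [norm_smul, Real.norm_two]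
    linarith
  rw [profile, χ.eq_one ξ (by linarith), χ.eq_one _ h2ξ, sub_self, Complex.ofReal_zero]

theorem profile_eq_zero_of_le_norm (χ : Cutoff d) {ξ : E d} (hξ : 2 ≤ ‖ξ‖) :
    χ.profile ξ = 0 := by
  have h2ξ : 2 ≤ ‖(2 : ℝ) • ξ‖ := by
    rw [norm_smul, Real.norm_two]
    linarith
  rw [profile, χ.eq_zero ξ hξ, χ.eq_zero _ h2ξ, sub_self, Complex.ofReal_zero]

theorem zero_notMem_tsupport_profile (χ : Cutoff d) : 0 ∉ tsupport χ.profile := by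
  rw [notMem_tsupport_iff_eventuallyEq]
  filter_upwards [Metric.closedBall_mem_nhds (0 : E d) (by norm_num : (0 : ℝ) < 1 / 2)] with ξ hξ
  exact χ.profile_eq_zero_of_norm_le (mem_closedBall_zero_iff.1 hξ)

theorem hasCompactSupport_profile (χ : Cutoff d) : HasCompactSupport χ.profile :=
  hasCompactSupport_of_eq_zero fun _ => χ.profile_eq_zero_of_le_norm

theorem symbol_succ (χ : Cutoff d) (n : ℕ) :
    (fun ξ => (χ.symbol (n + 1) ξ : ℂ)) = fun ξ => χ.profile (((2 : ℝ) ^ (n + 1))⁻¹ • ξ) := by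
  funext ξ
  have hdouble : (2 : ℝ) * ((2 : ℝ) ^ (n + 1))⁻¹ = ((2 : ℝ) ^ n)⁻¹ := by
    rw [pow_succ']
    field_simp
  rw [symbol, profile, smul_smul, hdouble]

theorem contDiff_symbol (χ : Cutoff d) (n : ℕ) :
    ContDiff ℝ (⊤ : ℕ∞) fun ξ => (χ.symbol n ξ : ℂ) := by
  cases n with
  | zero => exact Complex.ofRealCLM.contDiff.comp χ.smooth
  | succ n =>
    rw [χ.symbol_succ]
    exact χ.contDiff_profile.comp (contDiff_const_smul _)

theorem hasCompactSupport_symbol (χ : Cutoff d) (n : ℕ) :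
    HasCompactSupport fun ξ => (χ.symbol n ξ : ℂ) := by
  cases n with
  | zero =>
    refine hasCompactSupport_of_eq_zero (R := 2) fun ξ hξ => ?_
    rw [symbol, χ.eq_zero ξ hξ, Complex.ofReal_zero]
  | succ n =>
    rw [χ.symbol_succ]
    exact χ.hasCompactSupport_profile.comp_smul (by positivity)

theorem symbol_succ_eq_zero_of_norm_le (χ : Cutoff d) {n : ℕ} {ξ : E d} (hξ : ‖ξ‖ ≤ 2 ^ n) :
    (χ.symbol (n + 1) ξ : ℂ) = 0 := by
  refine (congrFun (χ.symbol_succ n) ξ).trans (χ.profile_eq_zero_of_norm_le ?_)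
  rw [norm_smul, norm_inv, Real.norm_of_nonneg (by positivity), inv_mul_le_iff₀ (by positivity),
    pow_succ]
  linarith

/-- The symbol `φₙ` as a Schwartz function. -/
def schwartzSymbol (χ : Cutoff d) (n : ℕ) : 𝓢(E d, ℂ) :=
  (χ.hasCompactSupport_symbol n).toSchwartzMap (χ.contDiff_symbol n)

theorem coe_fourierInv_schwartzSymbol (χ : Cutoff d) (n : ℕ) :
    ⇑(𝓕⁻ (χ.schwartzSymbol n) : 𝓢(E d, ℂ)) = χ.kernel n :=
  SchwartzMap.fourierInv_coe _

theorem continuous_kernel (χ : Cutoff d) (n : ℕ) : Continuous (χ.kernel n) :=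
  χ.coe_fourierInv_schwartzSymbol n ▸ SchwartzMap.continuous _

theorem memLp_kernel (χ : Cutoff d) (n : ℕ) (p : ℝ≥0∞) : MemLp (χ.kernel n) p volume :=
  χ.coe_fourierInv_schwartzSymbol n ▸ SchwartzMap.memLp _ p volume

theorem integrable_kernel (χ : Cutoff d) (n : ℕ) : Integrable (χ.kernel n) :=
  memLp_one_iff_integrable.1 (χ.memLp_kernel n 1)

/-- A bound for the `L¹` norms of all the kernels: those of `𝓕⁻¹ φₙ`, `n ≥ 1`, agree by scaling. -/
def mass (χ : Cutoff d) : ℝ≥0∞ := (∫⁻ x, ‖χ.kernel 0 x‖ₑ) + ∫⁻ x, ‖𝓕⁻ χ.profile x‖ₑ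

end Cutoff

theorem lintegral_enorm_fourierInv_lt_top {V : Type*} [NormedAddCommGroup V]
    [InnerProductSpace ℝ V] [FiniteDimensional ℝ V] [MeasurableSpace V] [BorelSpace V] {a : V → ℂ}
    (ha : ContDiff ℝ (⊤ : ℕ∞) a) (hac : HasCompactSupport a) : ∫⁻ x, ‖𝓕⁻ a x‖ₑ < ∞ := by
  have hcoe : ⇑(𝓕⁻ (hac.toSchwartzMap ha) : 𝓢(V, ℂ)) = 𝓕⁻ a := SchwartzMap.fourierInv_coe _
  exact hcoe ▸ (SchwartzMap.integrable (μ := volume) _).2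

namespace Cutoff

theorem mass_ne_top (χ : Cutoff d) : χ.mass ≠ ∞ :=
  (ENNReal.add_lt_top.2 ⟨(χ.integrable_kernel 0).2,
    lintegral_enorm_fourierInv_lt_top χ.contDiff_profile χ.hasCompactSupport_profile⟩).ne

theorem lintegral_enorm_kernel_le (χ : Cutoff d) (n : ℕ) :
    ∫⁻ x, ‖χ.kernel n x‖ₑ ≤ χ.mass := by
  cases n with
  | zero => exact le_self_add
  | succ n =>
    rw [kernel, χ.symbol_succ, lintegral_enorm_fourierInv_comp_smul _ (by positivity)]
    exact le_add_self

theorem eLpNorm_block_le (χ : Cutoff d) (n : ℕ) {f : E d → ℝ}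
    (hf : AEStronglyMeasurable f volume) {r : ℝ≥0∞} (hr : 1 ≤ r) :
    eLpNorm (χ.block n f) r volume ≤ χ.mass * eLpNorm f r volume := by
  calc eLpNorm (χ.block n f) r volume
      ≤ eLpNorm ((‖f ·‖ₑ) ⋆ₗ[volume] (‖χ.kernel n ·‖ₑ)) r volume :=
        eLpNorm_mono_enorm fun x => enorm_convolution_lsmul_le f (χ.kernel n) x
    _ ≤ (∫⁻ x, ‖χ.kernel n x‖ₑ) * eLpNorm (‖f ·‖ₑ) r volume :=
        eLpNorm_lconvolution_le hf.enorm (χ.continuous_kernel n).aemeasurable.enorm hr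
    _ ≤ χ.mass * eLpNorm f r volume := by
        rw [eLpNorm_enorm]
        gcongr
        exact χ.lintegral_enorm_kernel_le n

/-- The `n`-th Littlewood–Paley block as an operator on complex Schwartz functions. -/
def blockCLM (χ : Cutoff d) (n : ℕ) : 𝓢(E d, ℂ) →L[ℂ] 𝓢(E d, ℂ) :=
  SchwartzMap.fourierMultiplierCLM ℂ (χ.schwartzSymbol n)

theorem blockCLM_apply (χ : Cutoff d) (n : ℕ) (φ : 𝓢(E d, ℂ)) (x : E d) :
    χ.blockCLM n φ x = ∫ y, φ y * χ.kernel n (x - y) := by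
  rw [blockCLM, fourierMultiplierCLM_eq_convolution, coe_fourierInv_schwartzSymbol]
  rfl

theorem block_schwartz (χ : Cutoff d) (n : ℕ) (u : 𝓢(E d, ℝ)) :
    χ.block n u = χ.blockCLM n (schwartzOfReal u) := by
  funext x
  rw [blockCLM_apply]
  rfl

theorem fourier_blockCLM (χ : Cutoff d) (n : ℕ) (φ : 𝓢(E d, ℂ)) (ξ : E d) :
    𝓕 (χ.blockCLM n φ) ξ = χ.symbol n ξ * 𝓕 φ ξ :=
  fourier_fourierMultiplierCLM (χ.schwartzSymbol n).hasTemperateGrowth φ ξ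

theorem block_succ_eq_zero_of_isBandLimited (χ : Cutoff d) {n : ℕ} {u : 𝓢(E d, ℝ)}
    (hu : IsBandLimited (2 ^ n) (schwartzOfReal u)) : χ.block (n + 1) u = 0 := by
  have hzero : χ.blockCLM (n + 1) (schwartzOfReal u) = 0 := ext_fourier fun ξ => by
    rw [fourier_blockCLM, FourierTransform.fourier_zero, zero_apply]
    rcases le_total ‖ξ‖ (2 ^ n) with hξ | hξ
    · rw [χ.symbol_succ_eq_zero_of_norm_le hξ, zero_mul]
    · rw [hu ξ hξ, mul_zero]
  rw [block_schwartz, hzero]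
  rfl

end Cutoff

section Weights

theorem two_rpow_add (a b : ℝ) : (2 : ℝ≥0∞) ^ (a + b) = 2 ^ a * 2 ^ b :=
  ENNReal.rpow_add a b (by norm_num) (by norm_num)

theorem tsum_two_rpow_neg_ne_top {α : ℝ} (hα : 0 < α) :
    ∑' n : ℕ, (2 : ℝ≥0∞) ^ (-((n : ℝ) * α)) ≠ ∞ := by
  have hgeom (n : ℕ) : (2 : ℝ≥0∞) ^ (-((n : ℝ) * α)) = (2 ^ (-α)) ^ n := by
    rw [← ENNReal.rpow_natCast, ← ENNReal.rpow_mul, neg_mul, mul_comm]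
  simp only [hgeom, ENNReal.tsum_geometric, ne_eq, ENNReal.inv_eq_top, tsub_eq_zero_iff_le, not_le]
  exact ENNReal.rpow_lt_one_of_one_lt_of_neg (by norm_num) (neg_neg_of_pos hα)

theorem sum_two_rpow_le (α : ℝ) (n : ℕ) :
    ∑ l ∈ Finset.range (n + 1), (2 : ℝ≥0∞) ^ ((l : ℝ) * α) ≤
      (∑' l : ℕ, (2 : ℝ≥0∞) ^ (-((l : ℝ) * α))) * 2 ^ ((n : ℝ) * α) := by
  rw [← Finset.sum_range_reflect, ← ENNReal.tsum_mul_right]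
  refine (Finset.sum_congr rfl fun l hl => ?_).trans_le
    (ENNReal.sum_le_tsum (Finset.range (n + 1)))
  rw [← two_rpow_add, Nat.add_sub_cancel,
    Nat.cast_sub (Nat.lt_succ_iff.1 (Finset.mem_range.1 hl))]
  congr 1
  ring

end Weights

section BandLimited

theorem besovNorm_one (χ : Cutoff d) (α : ℝ) (r : ℝ≥0∞) (f : E d → ℝ) :
    besovNorm χ α r 1 f =
      ∑' n : ℕ, (2 : ℝ≥0∞) ^ ((n : ℝ) * α) * eLpNorm (χ.block n f) r volume := by
  simp only [besovNorm, eLpNorm_one_eq_lintegral_enorm, lintegral_count, enorm_eq_self]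

theorem besovNorm_one_le_of_isBandLimited (χ : Cutoff d) (α : ℝ) {r : ℝ≥0∞} (hr : 1 ≤ r) {n : ℕ}
    {u : 𝓢(E d, ℝ)} (hu : IsBandLimited (2 ^ n) (schwartzOfReal u)) :
    besovNorm χ α r 1 u ≤ (∑' l : ℕ, (2 : ℝ≥0∞) ^ (-((l : ℝ) * α))) * 2 ^ ((n : ℝ) * α) *
      (χ.mass * eLpNorm u r volume) := by
  have hvanish : ∀ l ∉ Finset.range (n + 1),
      (2 : ℝ≥0∞) ^ ((l : ℝ) * α) * eLpNorm (χ.block l u) r volume = 0 := by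
    intro l hl
    obtain ⟨k, rfl⟩ := Nat.exists_eq_add_one_of_ne_zero (n := l) (by grind)
    have hnk : n ≤ k := by grind
    rw [χ.block_succ_eq_zero_of_isBandLimited fun ξ hξ =>
      hu ξ ((pow_le_pow_right₀ one_le_two hnk).trans hξ), eLpNorm_zero, mul_zero]
  calc besovNorm χ α r 1 u
      = ∑ l ∈ Finset.range (n + 1),
          (2 : ℝ≥0∞) ^ ((l : ℝ) * α) * eLpNorm (χ.block l u) r volume := by
        rw [besovNorm_one, tsum_eq_sum hvanish]
    _ ≤ ∑ l ∈ Finset.range (n + 1),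
          (2 : ℝ≥0∞) ^ ((l : ℝ) * α) * (χ.mass * eLpNorm u r volume) := by
        gcongr
        exact χ.eLpNorm_block_le _ u.continuous.aestronglyMeasurable hr
    _ ≤ _ := by
        rw [← Finset.sum_mul]
        gcongr
        exact sum_two_rpow_le α n

end BandLimited

/-! ### Gain on blocks -/

section DyadicGain

theorem fourierMultiplierCLM_eq_sum_schwartzDiff {V : Type*} [NormedAddCommGroup V]
    [InnerProductSpace ℝ V] [FiniteDimensional ℝ V] [MeasurableSpace V] [BorelSpace V]
    {ι : Type*} [Fintype ι] {a : V → ℂ} (ha : a.HasTemperateGrowth) {M : ι → V → ℂ}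
    (hM : ∀ j, (M j).HasTemperateGrowth) {h : ι → V} (m : ℕ)
    (hsum : ∀ ξ, a ξ = ∑ j, (translationSymbol (h j) ξ - 1) ^ m * M j ξ) (φ : 𝓢(V, ℂ)) :
    SchwartzMap.fourierMultiplierCLM ℂ a φ =
      ∑ j, (schwartzDiff (h j))^[m] (SchwartzMap.fourierMultiplierCLM ℂ (M j) φ) := by
  refine ext_fourier fun ξ => ?_
  rw [show 𝓕 (∑ j, (schwartzDiff (h j))^[m] (SchwartzMap.fourierMultiplierCLM ℂ (M j) φ)) =
      ∑ j, 𝓕 ((schwartzDiff (h j))^[m] (SchwartzMap.fourierMultiplierCLM ℂ (M j) φ)) from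
    map_sum (FourierTransform.fourierCLM ℂ 𝓢(V, ℂ)) _ _, sum_apply, fourier_fourierMultiplierCLM ha,
    hsum, Finset.sum_mul]
  simp only [fourier_schwartzDiff_iterate, fourier_fourierMultiplierCLM (hM _), mul_assoc]

/-- The functional `T` gains `s` derivatives on `m`-th differences of real Schwartz functions,
measured in `B^α_{r,1}`. This is the form in which both hypotheses of the theorem are used:
`B^α_{r,1}` embeds into `B^α_{∞,∞}` for `r = ∞`, and into `F^α_{r,∞}` in general. -/
def GainsOnDifferences (χ : Cutoff d) (m : ℕ) (s α : ℝ) (r K : ℝ≥0∞) (T : 𝓢(E d, ℂ) →ₗ[ℂ] ℂ) :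
    Prop :=
  ∀ (u : 𝓢(E d, ℝ)) (h : E d), ‖h‖ ≤ 1 →
    ‖T (schwartzOfReal ((schwartzDiff h)^[m] u))‖ₑ ≤ K * ‖h‖ₑ ^ s * besovNorm χ α r 1 u

variable {χ : Cutoff d} {m n : ℕ} {s α : ℝ} {r K : ℝ≥0∞} {T : 𝓢(E d, ℂ) →ₗ[ℂ] ℂ}

theorem GainsOnDifferences.enorm_apply_le_of_isBandLimited (hT : GainsOnDifferences χ m s α r K T)
    (hr : 1 ≤ r) {φ : 𝓢(E d, ℂ)} (hφ : IsBandLimited (2 ^ n) φ) {h : E d} (hh : ‖h‖ ≤ 1) :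
    ‖T ((schwartzDiff h)^[m] φ)‖ₑ ≤ 2 * (K * ‖h‖ₑ ^ s *
      ((∑' l : ℕ, (2 : ℝ≥0∞) ^ (-((l : ℝ) * α))) * 2 ^ ((n : ℝ) * α) *
        (χ.mass * eLpNorm φ r volume))) := by
  have hreal {u : 𝓢(E d, ℝ)} (hu : IsBandLimited (2 ^ n) (schwartzOfReal u))
      (huφ : ∀ x, ‖u x‖ ≤ ‖φ x‖) : ‖T (schwartzOfReal ((schwartzDiff h)^[m] u))‖ₑ ≤
        K * ‖h‖ₑ ^ s * ((∑' l : ℕ, (2 : ℝ≥0∞) ^ (-((l : ℝ) * α))) * 2 ^ ((n : ℝ) * α) *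
          (χ.mass * eLpNorm φ r volume)) := by
    refine (hT u h hh).trans ?_
    gcongr
    refine (besovNorm_one_le_of_isBandLimited χ α hr hu).trans ?_
    gcongr
    exact eLpNorm_mono huφ
  rw [schwartzDiff_iterate_eq_re_add_I_smul_im, map_add, map_smul, two_mul]
  refine (enorm_add_le _ _).trans (add_le_add
    (hreal hφ.schwartzRe fun x => Complex.abs_re_le_norm (φ x)) ?_)
  rw [enorm_smul, ← ofReal_norm Complex.I, Complex.norm_I, ENNReal.ofReal_one, one_mul]
  exact hreal hφ.schwartzIm fun x => Complex.abs_im_le_norm (φ x)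

theorem isBandLimited_fourierMultiplierCLM_comp_smul {a : E d → ℂ} (ha : ContDiff ℝ (⊤ : ℕ∞) a)
    (ha_zero : ∀ ξ, 2 ≤ ‖ξ‖ → a ξ = 0) (n : ℕ) (φ : 𝓢(E d, ℂ)) :
    IsBandLimited (2 ^ (n + 1))
      (SchwartzMap.fourierMultiplierCLM ℂ (fun ξ => a (((2 : ℝ) ^ n)⁻¹ • ξ)) φ) := by
  intro ξ hξ
  have hgrowth := ((hasCompactSupport_of_eq_zero ha_zero).comp_smul
    (by positivity : ((2 : ℝ) ^ n)⁻¹ ≠ 0)).hasTemperateGrowth (ha.comp (contDiff_const_smul _))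
  rw [fourier_fourierMultiplierCLM hgrowth, ha_zero, zero_mul]
  rwa [norm_smul, norm_inv, Real.norm_of_nonneg (by positivity), le_inv_mul_iff₀ (by positivity),
    ← pow_succ]

theorem eLpNorm_fourierMultiplierCLM_comp_smul_le {a : E d → ℂ} (ha : ContDiff ℝ (⊤ : ℕ∞) a)
    (hac : HasCompactSupport a) {c : ℝ} (hc : c ≠ 0) (φ : 𝓢(E d, ℂ)) (hr : 1 ≤ r) :
    eLpNorm (SchwartzMap.fourierMultiplierCLM ℂ (fun ξ => a (c • ξ)) φ) r volume ≤
      (∫⁻ x, ‖𝓕⁻ a x‖ₑ) * eLpNorm φ r volume := by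
  rw [← lintegral_enorm_fourierInv_comp_smul a hc]
  exact eLpNorm_fourierMultiplierCLM_le
    ((hac.comp_smul hc).toSchwartzMap (ha.comp (contDiff_const_smul c))) φ hr

theorem two_rpow_gain (n : ℕ) (s α : ℝ) :
    ((2 : ℝ≥0∞) ^ (n + 2))⁻¹ ^ s * 2 ^ (((n + 1 : ℕ) : ℝ) * α) =
      2 ^ (α - 2 * s) * 2 ^ (-((n : ℝ) * (s - α))) := by
  rw [← ENNReal.rpow_natCast, ← ENNReal.rpow_neg, ← ENNReal.rpow_mul, ← two_rpow_add,
    ← two_rpow_add]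
  push_cast
  ring_nf

theorem GainsOnDifferences.enorm_apply_dyadic_le (hT : GainsOnDifferences χ m s α r K T)
    (hr : 1 ≤ r) {a : E d → ℂ} (ha : ContDiff ℝ (⊤ : ℕ∞) a) (ha_zero : ∀ ξ, 2 ≤ ‖ξ‖ → a ξ = 0)
    (n : ℕ) {h : E d} (hh : ‖h‖ₑ = (2 ^ (n + 2))⁻¹) (φ : 𝓢(E d, ℂ)) :
    ‖T ((schwartzDiff h)^[m]
        (SchwartzMap.fourierMultiplierCLM ℂ (fun ξ => a (((2 : ℝ) ^ n)⁻¹ • ξ)) φ))‖ₑ ≤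
      2 ^ (1 + α - 2 * s) * (∑' l : ℕ, (2 : ℝ≥0∞) ^ (-((l : ℝ) * α))) * χ.mass *
        (∫⁻ x, ‖𝓕⁻ a x‖ₑ) * (K * 2 ^ (-((n : ℝ) * (s - α))) * eLpNorm φ r volume) := by
  have hh_le : ‖h‖ ≤ 1 := by
    rw [← ENNReal.ofReal_le_one, ofReal_norm, hh, ENNReal.inv_le_one]
    exact one_le_pow₀ one_le_two
  have hsize := eLpNorm_fourierMultiplierCLM_comp_smul_le ha (hasCompactSupport_of_eq_zero ha_zero)
    (by positivity : ((2 : ℝ) ^ n)⁻¹ ≠ 0) φ hr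
  calc _ ≤ 2 * (K * ((2 : ℝ≥0∞) ^ (n + 2))⁻¹ ^ s * ((∑' l : ℕ, (2 : ℝ≥0∞) ^ (-((l : ℝ) * α))) *
          2 ^ (((n + 1 : ℕ) : ℝ) * α) *
          (χ.mass * ((∫⁻ x, ‖𝓕⁻ a x‖ₑ) * eLpNorm φ r volume)))) := by
        refine (hT.enorm_apply_le_of_isBandLimited hr
          (isBandLimited_fourierMultiplierCLM_comp_smul ha ha_zero n φ) hh_le).trans ?_
        rw [hh]
        gcongr
    _ = 2 * (((2 : ℝ≥0∞) ^ (n + 2))⁻¹ ^ s * 2 ^ (((n + 1 : ℕ) : ℝ) * α)) *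
          (K * (∑' l : ℕ, (2 : ℝ≥0∞) ^ (-((l : ℝ) * α))) *
          (χ.mass * ((∫⁻ x, ‖𝓕⁻ a x‖ₑ) * eLpNorm φ r volume))) := by ring
    _ = _ := by
        rw [two_rpow_gain, show (1 + α - 2 * s : ℝ) = 1 + (α - 2 * s) by ring, two_rpow_add 1,
          ENNReal.rpow_one]
        ring

theorem exists_enorm_blockCLM_succ_le (χ χ' : Cutoff d) (m : ℕ) (s : ℝ) (hα : 0 < α)
    (hr : 1 ≤ r) :
    ∃ C : ℝ≥0∞, C ≠ ∞ ∧ ∀ (T : 𝓢(E d, ℂ) →ₗ[ℂ] ℂ) (K : ℝ≥0∞), GainsOnDifferences χ m s α r K T →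
      ∀ (n : ℕ) (φ : 𝓢(E d, ℂ)), ‖T (χ'.blockCLM (n + 1) φ)‖ₑ ≤
        C * (K * 2 ^ (-(((n + 1 : ℕ) : ℝ) * (s - α))) * eLpNorm φ r volume) := by
  set b := EuclideanSpace.basisFun (Fin d) ℝ
  obtain ⟨M, hM, hM_zero, hsum⟩ := exists_eq_sum_translationSymbol_sub_one_pow_mul b m
    χ'.contDiff_profile χ'.zero_notMem_tsupport_profile (c := 1 / 4) (by norm_num)
    (by norm_num [abs_of_pos]) fun _ => χ'.profile_eq_zero_of_le_norm
  have hM_supp (j : Fin d) (ξ : E d) (hξ : 2 ≤ ‖ξ‖) : M j ξ = 0 :=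
    hM_zero j ξ (χ'.profile_eq_zero_of_le_norm hξ)
  have hMc (j : Fin d) : HasCompactSupport (M j) := hasCompactSupport_of_eq_zero (hM_supp j)
  refine ⟨∑ j, 2 ^ (1 + α - 2 * s) * (∑' l : ℕ, (2 : ℝ≥0∞) ^ (-((l : ℝ) * α))) * χ.mass *
    ∫⁻ x, ‖𝓕⁻ (M j) x‖ₑ, ?_, fun T K hT n φ => ?_⟩
  · refine ENNReal.sum_ne_top.2 fun j _ => ENNReal.mul_ne_top (ENNReal.mul_ne_top
      (ENNReal.mul_ne_top ?_ (tsum_two_rpow_neg_ne_top hα)) χ.mass_ne_top)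
      (lintegral_enorm_fourierInv_lt_top (hM j) (hMc j)).ne
    exact ENNReal.rpow_ne_top_of_ne_zero (by norm_num) (by norm_num)
  set c : ℝ := ((2 : ℝ) ^ (n + 1))⁻¹ with hc
  have hc_ne : c ≠ 0 := by positivity
  have hstep (j : Fin d) : ‖c • (1 / 4 : ℝ) • b j‖ₑ = (2 ^ (n + 1 + 2))⁻¹ := by
    rw [smul_smul, enorm_smul, ← ofReal_norm (b j), b.norm_eq_one, ENNReal.ofReal_one, mul_one,
      show c * (1 / 4) = ((2 : ℝ) ^ (n + 1 + 2))⁻¹ by rw [hc, pow_add _ _ 2]; ring,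
      enorm_inv (by positivity), enorm_pow, Real.enorm_eq_ofReal zero_le_two, ENNReal.ofReal_ofNat]
  have hblock : χ'.blockCLM (n + 1) φ = ∑ j, (schwartzDiff (c • (1 / 4 : ℝ) • b j))^[m]
      (SchwartzMap.fourierMultiplierCLM ℂ (fun ξ => M j (c • ξ)) φ) := by
    refine fourierMultiplierCLM_eq_sum_schwartzDiff (χ'.schwartzSymbol _).hasTemperateGrowth
      (fun j => ((hMc j).comp_smul hc_ne).hasTemperateGrowth ((hM j).comp (contDiff_const_smul c)))
      m (fun ξ => ?_) φ
    simp only [translationSymbol_smul c]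
    exact (congrFun (χ'.symbol_succ n) ξ).trans (hsum (c • ξ))
  rw [hblock, map_sum, Finset.sum_mul]
  exact (enorm_sum_le _ _).trans (Finset.sum_le_sum fun j _ =>
    hT.enorm_apply_dyadic_le hr (hM j) (hM_supp j) (n + 1) (hstep j) φ)

end DyadicGain

/-! ### Duality -/

section ComparisonWithSums

theorem eLpNorm_top_count_le {ι : Type*} [MeasurableSpace ι] [MeasurableSingletonClass ι]
    {a : ι → ℝ≥0∞} {c : ℝ≥0∞} (h : ∀ i, a i ≤ c) : eLpNorm a ∞ Measure.count ≤ c := by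
  simpa only [eLpNorm_exponent_top, eLpNormEssSup_count, enorm_eq_self] using iSup_le h

theorem tsum_rpow_le {ι : Type*} (b : ι → ℝ≥0∞) {q : ℝ} (hq : 1 ≤ q) :
    ∑' i, b i ^ q ≤ (∑' i, b i) ^ q := by
  have hsplit (x : ℝ≥0∞) : x ^ q = x * x ^ (q - 1) := by
    conv_lhs => rw [← add_sub_cancel 1 q, ENNReal.rpow_add_of_nonneg _ _ zero_le_one
      (sub_nonneg.2 hq), ENNReal.rpow_one]
  rw [hsplit, ← ENNReal.tsum_mul_right]
  refine ENNReal.tsum_le_tsum fun i => ?_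
  rw [hsplit]
  gcongr
  exact ENNReal.le_tsum i

theorem eLpNorm_eLpNorm_top_count_le {Ω : Type*} [MeasurableSpace Ω] {μ : Measure Ω}
    {r : ℝ≥0∞} (hr : 1 ≤ r) (hr_top : r ≠ ∞) {a : ℕ → Ω → ℝ≥0∞} (ha : ∀ n, AEMeasurable (a n) μ) :
    eLpNorm (fun x => eLpNorm (fun n => a n x) ∞ Measure.count) r μ ≤
      ∑' n, eLpNorm (a n) r μ := by
  have hr_ne : r ≠ 0 := (zero_lt_one.trans_le hr).ne'
  have hr_real : 1 ≤ r.toReal := by simpa using ENNReal.toReal_mono hr_top hr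
  have hr_pos : 0 < r.toReal := zero_lt_one.trans_le hr_real
  have hpow (f : Ω → ℝ≥0∞) : eLpNorm f r μ ^ r.toReal = ∫⁻ x, f x ^ r.toReal ∂μ := by
    rw [eLpNorm_eq_lintegral_rpow_enorm_toReal hr_ne hr_top, one_div,
      ENNReal.rpow_inv_rpow hr_pos.ne']
    simp only [enorm_eq_self]
  rw [← ENNReal.rpow_le_rpow_iff hr_pos, hpow]
  calc ∫⁻ x, eLpNorm (fun n => a n x) ∞ Measure.count ^ r.toReal ∂μ
      ≤ ∫⁻ x, ∑' n, a n x ^ r.toReal ∂μ := by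
        refine lintegral_mono fun x => ?_
        rw [← ENNReal.le_rpow_inv_iff hr_pos]
        refine eLpNorm_top_count_le fun n => ?_
        rw [ENNReal.le_rpow_inv_iff hr_pos]
        exact ENNReal.le_tsum (f := fun n => a n x ^ r.toReal) n
    _ = ∑' n, eLpNorm (a n) r μ ^ r.toReal := by
        rw [lintegral_tsum fun n => (ha n).pow_const _]
        simp only [hpow]
    _ ≤ (∑' n, eLpNorm (a n) r μ) ^ r.toReal := tsum_rpow_le _ hr_real

theorem eLpNorm_const_mul_enorm_le {Ω F : Type*} [MeasurableSpace Ω] {μ : Measure Ω}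
    [NormedAddCommGroup F] {r c : ℝ≥0∞} (hc : c ≠ ∞) (f : Ω → F) :
    eLpNorm (fun x => c * ‖f x‖ₑ) r μ ≤ c * eLpNorm f r μ := by
  lift c to NNReal using hc
  exact eLpNorm_le_nnreal_smul_eLpNorm_of_ae_le_mul' (Eventually.of_forall fun x => le_rfl) r

theorem besovNorm_top_le_one (χ : Cutoff d) (α : ℝ) (r : ℝ≥0∞) (f : E d → ℝ) :
    besovNorm χ α r ∞ f ≤ besovNorm χ α r 1 f := by
  rw [besovNorm_one, besovNorm]
  exact eLpNorm_top_count_le fun n => ENNReal.le_tsum n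

theorem triebelLizorkinNorm_top_le_besovNorm_one (χ : Cutoff d) (α : ℝ) {r : ℝ≥0∞} (hr : 1 ≤ r)
    (hr_top : r ≠ ∞) {f : E d → ℝ} (hf : ∀ n, AEStronglyMeasurable (χ.block n f) volume) :
    triebelLizorkinNorm χ α r ∞ f ≤ besovNorm χ α r 1 f := by
  rw [besovNorm_one, triebelLizorkinNorm]
  refine (eLpNorm_eLpNorm_top_count_le hr hr_top
    fun n => ((hf n).enorm.const_mul _)).trans (ENNReal.tsum_le_tsum fun n => ?_)
  exact eLpNorm_const_mul_enorm_le (f := χ.block n f) (by finiteness)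

end ComparisonWithSums

section ShrinkingBump

variable {V : Type*} [NormedAddCommGroup V]

/-- A sequence of bump functions centred at `0` whose supports shrink to a point. -/
def shrinkingBump (n : ℕ) : ContDiffBump (0 : V) where
  rIn := 1 / (n + 1)
  rOut := 2 / (n + 1)
  rIn_pos := by positivity
  rIn_lt_rOut := by gcongr; norm_num

theorem shrinkingBump_rOut_le (n : ℕ) : (shrinkingBump n : ContDiffBump (0 : V)).rOut ≤ 2 :=
  div_le_self zero_le_two (by simp)

end ShrinkingBump

section Duality

theorem memLp_of_bound_of_bounded_support {V : Type*} [NormedAddCommGroup V] [ProperSpace V]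
    [MeasurableSpace V] {μ : Measure V} [IsFiniteMeasureOnCompacts μ] {p : ℝ≥0∞} {f : V → ℝ}
    (hf : AEStronglyMeasurable f μ) {M R : ℝ} (hfM : ∀ x, ‖f x‖ ≤ M)
    (hfR : ∀ x, R < ‖x‖ → f x = 0) : MemLp f p μ :=
  (memLp_top_of_bound hf M (Eventually.of_forall hfM)).mono_exponent_of_measure_support_ne_top
    (s := Metric.closedBall 0 R) (fun x hx => hfR x (by simpa using hx))
    (isCompact_closedBall 0 R).measure_lt_top.ne le_top

theorem eLpNorm_le_two_mul_of_re_of_im {Ω : Type*} [MeasurableSpace Ω] {μ : Measure Ω}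
    {p B : ℝ≥0∞} (hp : 1 ≤ p) {F : Ω → ℂ} (hF : AEStronglyMeasurable F μ)
    (hre : eLpNorm (fun x => (F x).re) p μ ≤ B) (him : eLpNorm (fun x => (F x).im) p μ ≤ B) :
    eLpNorm F p μ ≤ 2 * B := by
  calc eLpNorm F p μ
      ≤ eLpNorm (fun x => ‖(F x).re‖ + ‖(F x).im‖) p μ :=
        eLpNorm_mono_real fun x => Complex.norm_le_abs_re_add_abs_im (F x)
    _ ≤ eLpNorm (fun x => ‖(F x).re‖) p μ + eLpNorm (fun x => ‖(F x).im‖) p μ :=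
        eLpNorm_add_le (Complex.continuous_re.comp_aestronglyMeasurable hF).norm
          (Complex.continuous_im.comp_aestronglyMeasurable hF).norm hp
    _ ≤ 2 * B := by
        rw [eLpNorm_norm, eLpNorm_norm, two_mul]
        exact add_le_add hre him

variable {V : Type*} [NormedAddCommGroup V] [NormedSpace ℝ V] [FiniteDimensional ℝ V]
  [MeasurableSpace V] [BorelSpace V] {μ : Measure V} {p q B : ℝ≥0∞}

theorem eLpNorm_normed_convolution_le [μ.IsAddHaarMeasure] (φ : ContDiffBump (0 : V)) {G : V → ℝ}
    (hG : AEStronglyMeasurable G μ) (hq : 1 ≤ q) :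
    eLpNorm (φ.normed μ ⋆[ContinuousLinearMap.lsmul ℝ ℝ, μ] G) q μ ≤ eLpNorm G q μ := by
  have hmass : ∫⁻ x, ‖φ.normed μ x‖ₑ ∂μ = 1 := by
    rw [← ofReal_integral_norm_eq_lintegral_enorm φ.integrable_normed]
    simp only [Real.norm_of_nonneg (φ.nonneg_normed _), φ.integral_normed, ENNReal.ofReal_one]
  calc eLpNorm (φ.normed μ ⋆[ContinuousLinearMap.lsmul ℝ ℝ, μ] G) q μ
      ≤ eLpNorm ((‖G ·‖ₑ) ⋆ₗ[μ] (‖φ.normed μ ·‖ₑ)) q μ := by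
        rw [lconvolution_comm]
        exact eLpNorm_mono_enorm fun x => enorm_convolution_lsmul_le (φ.normed μ) G x
    _ ≤ (∫⁻ x, ‖φ.normed μ x‖ₑ ∂μ) * eLpNorm (‖G ·‖ₑ) q μ :=
        eLpNorm_lconvolution_le hG.enorm φ.continuous_normed.aemeasurable.enorm hq
    _ = eLpNorm G q μ := by rw [hmass, one_mul, eLpNorm_enorm]

theorem norm_normed_convolution_le [μ.IsAddHaarMeasure] (φ : ContDiffBump (0 : V)) {G : V → ℝ}
    {M : ℝ} (hG : ∀ x, ‖G x‖ ≤ M) (x : V) :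
    ‖(φ.normed μ ⋆[ContinuousLinearMap.lsmul ℝ ℝ, μ] G) x‖ ≤ M := by
  rw [convolution_def]
  refine (norm_integral_le_of_norm_le (φ.integrable_normed.mul_const M)
    (Eventually.of_forall fun t => ?_)).trans_eq ?_
  · rw [ContinuousLinearMap.lsmul_apply, norm_smul, Real.norm_of_nonneg (φ.nonneg_normed t)]
    exact mul_le_mul_of_nonneg_left (hG _) (φ.nonneg_normed t)
  · rw [integral_mul_const, φ.integral_normed, one_mul]

theorem normed_convolution_eq_zero [μ.IsAddHaarMeasure] (φ : ContDiffBump (0 : V)) {G : V → ℝ}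
    {R : ℝ} (hG : ∀ x, R < ‖x‖ → G x = 0) {x : V} (hx : R + φ.rOut ≤ ‖x‖) :
    (φ.normed μ ⋆[ContinuousLinearMap.lsmul ℝ ℝ, μ] G) x = 0 := by
  rw [convolution_def]
  refine integral_eq_zero_of_ae (Eventually.of_forall fun t => ?_)
  by_cases ht : t ∈ Function.support (φ.normed μ)
  · rw [φ.support_normed_eq, mem_ball_zero_iff] at ht
    have := norm_sub_norm_le x t
    simp [hG (x - t) (by linarith)]
  · simp [Function.notMem_support.1 ht]

theorem ae_tendsto_shrinkingBump_convolution [μ.IsAddHaarMeasure] {G : V → ℝ}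
    (hG : LocallyIntegrable G μ) :
    ∀ᵐ x ∂μ, Tendsto (fun n => ((shrinkingBump n).normed μ
      ⋆[ContinuousLinearMap.lsmul ℝ ℝ, μ] G) x) atTop (𝓝 (G x)) := by
  refine ContDiffBump.ae_convolution_tendsto_right_of_locallyIntegrable (K := 2) ?_
    (Eventually.of_forall fun n => ?_) hG
  · simpa [shrinkingBump, div_eq_mul_inv] using
      (tendsto_one_div_add_atTop_nhds_zero_nat (𝕜 := ℝ)).const_mul 2
  · simp [shrinkingBump, div_eq_mul_inv]

theorem enorm_integral_mul_le_of_forall_contDiff [μ.IsAddHaarMeasure] (hq : 1 ≤ q) {F G : V → ℝ}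
    (hF : LocallyIntegrable F μ) (hG : AEStronglyMeasurable G μ) {M R : ℝ} (hGM : ∀ x, ‖G x‖ ≤ M)
    (hGR : ∀ x, R < ‖x‖ → G x = 0)
    (h : ∀ g : V → ℝ, ContDiff ℝ (⊤ : ℕ∞) g → HasCompactSupport g →
      ‖∫ x, g x * F x ∂μ‖ₑ ≤ B * eLpNorm g q μ) :
    ‖∫ x, G x * F x ∂μ‖ₑ ≤ B * eLpNorm G q μ := by
  have hGc : HasCompactSupport G := HasCompactSupport.intro (isCompact_closedBall 0 R)
    fun x hx => hGR x (by simpa using hx)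
  have hGi : LocallyIntegrable G μ :=
    (memLp_top_of_bound hG M (Eventually.of_forall hGM)).locallyIntegrable le_top
  set g : ℕ → V → ℝ := fun n =>
    (shrinkingBump n).normed μ ⋆[ContinuousLinearMap.lsmul ℝ ℝ, μ] G
  have hg_smooth (n : ℕ) : ContDiff ℝ (⊤ : ℕ∞) (g n) :=
    (shrinkingBump n).hasCompactSupport_normed.contDiff_convolution_left _
      (shrinkingBump n).contDiff_normed hGi
  have hg_zero (n : ℕ) {x : V} (hx : x ∉ Metric.closedBall (0 : V) (R + 2)) : g n x = 0 := by
    refine normed_convolution_eq_zero _ hGR ?_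
    have := shrinkingBump_rOut_le (V := V) n
    rw [mem_closedBall_zero_iff, not_le] at hx
    linarith
  have hlim : Tendsto (fun n => ∫ x, g n x * F x ∂μ) atTop (𝓝 (∫ x, G x * F x ∂μ)) := by
    refine tendsto_integral_of_dominated_convergence
      ((Metric.closedBall 0 (R + 2)).indicator fun x => M * ‖F x‖)
      (fun n => (hg_smooth n).continuous.aestronglyMeasurable.mul hF.aestronglyMeasurable) ?_
      (fun n => Eventually.of_forall fun x => ?_) ?_
    · exact (integrable_indicator_iff measurableSet_closedBall).2
        ((hF.integrableOn_isCompact (isCompact_closedBall _ _)).norm.const_mul M)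
    · by_cases hx : x ∈ Metric.closedBall (0 : V) (R + 2)
      · rw [Set.indicator_of_mem hx, norm_mul]
        exact mul_le_mul_of_nonneg_right (norm_normed_convolution_le _ hGM x) (norm_nonneg _)
      · rw [Set.indicator_of_notMem hx, hg_zero n hx, zero_mul, norm_zero]
    · filter_upwards [ae_tendsto_shrinkingBump_convolution hGi] with x hx using hx.mul_const _
  refine le_of_tendsto hlim.enorm (Eventually.of_forall fun n => ?_)
  have hg_compact := (shrinkingBump n).hasCompactSupport_normed (μ := μ) |>.convolution
    (ContinuousLinearMap.lsmul ℝ ℝ) hGc (μ := μ)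
  refine (h (g n) (hg_smooth n) hg_compact).trans ?_
  gcongr
  exact eLpNorm_normed_convolution_le _ hG hq

theorem abs_rpow_sub_two_mul_le (y a : ℝ) : |(|y| ^ (a - 2) * y)| ≤ |y| ^ (a - 1) := by
  rcases eq_or_ne y 0 with rfl | hy
  · simpa using Real.rpow_nonneg le_rfl _
  · rw [abs_mul, abs_of_nonneg (by positivity), ← Real.rpow_add_one (abs_pos.2 hy).ne']
    ring_nf
    rfl

theorem abs_rpow_sub_two_mul_mul_self (y : ℝ) {a : ℝ} (ha : a ≠ 0) :
    |y| ^ (a - 2) * y * y = |y| ^ a := by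
  rcases eq_or_ne y 0 with rfl | hy
  · simp [ha]
  · rw [mul_assoc, ← abs_mul_abs_self, ← mul_assoc, ← Real.rpow_add_one (abs_pos.2 hy).ne',
      ← Real.rpow_add_one (abs_pos.2 hy).ne']
    ring_nf

theorem eLpNorm_abs_rpow_sub_two_mul_le {Ω : Type*} [MeasurableSpace Ω] {μ : Measure Ω}
    [p.HolderConjugate q] (hp : p ≠ ∞) (f : Ω → ℝ) :
    eLpNorm (fun x => |f x| ^ (p.toReal - 2) * f x) q μ ≤ eLpNorm f p μ ^ (p.toReal - 1) := by
  have hp_one : 1 ≤ p := ENNReal.HolderConjugate.one_le p q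
  refine (eLpNorm_mono_real fun x => abs_rpow_sub_two_mul_le (f x) p.toReal).trans ?_
  rcases hp_one.eq_or_lt with rfl | hp_lt
  · obtain rfl := ENNReal.HolderConjugate.unique 1 q ∞
    simpa using eLpNormEssSup_le_of_ae_bound (f := fun _ : Ω => (1 : ℝ)) (μ := μ) (C := 1)
      (Eventually.of_forall fun _ => by simp)
  · have hp_pos : 0 < p.toReal - 1 := by
      simpa using (ENNReal.toReal_lt_toReal ENNReal.one_ne_top hp).2 hp_lt
    have hqp : q * ENNReal.ofReal (p.toReal - 1) = p := by
      rw [ENNReal.ofReal_sub _ zero_le_one, ENNReal.ofReal_toReal hp, ENNReal.ofReal_one,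
        ← ENNReal.HolderConjugate.div_conj_eq_sub_one (p := p) (q := q)]
      exact ENNReal.mul_div_cancel (ENNReal.HolderConjugate.ne_zero q p)
        ((ENNReal.HolderConjugate.lt_top_iff_one_lt q p).2 hp_lt).ne
    simp only [← Real.norm_eq_abs]
    rw [eLpNorm_norm_rpow f hp_pos, hqp]

theorem enorm_integral_abs_rpow_sub_two_mul_mul {Ω : Type*} [MeasurableSpace Ω] {μ : Measure Ω}
    (hp_zero : p ≠ 0) (hp_top : p ≠ ∞) {f F : Ω → ℝ} (hf : MemLp f p μ)
    (hfF : ∀ x, f x = 0 ∨ f x = F x) :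
    ‖∫ x, |f x| ^ (p.toReal - 2) * f x * F x ∂μ‖ₑ = eLpNorm f p μ ^ p.toReal := by
  have hp_pos : 0 < p.toReal := ENNReal.toReal_pos hp_zero hp_top
  have hpow (x : Ω) : |f x| ^ (p.toReal - 2) * f x * F x = ‖f x‖ ^ p.toReal := by
    rw [Real.norm_eq_abs, ← abs_rpow_sub_two_mul_mul_self (f x) hp_pos.ne']
    rcases hfF x with hx | hx
    · simp only [hx, mul_zero, zero_mul]
    · rw [← hx]
  rw [hf.eLpNorm_eq_integral_rpow_norm hp_zero hp_top,
    ENNReal.ofReal_rpow_of_nonneg (by positivity) hp_pos.le,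
    Real.rpow_inv_rpow (by positivity) hp_pos.ne', ← Real.enorm_eq_ofReal (by positivity)]
  simp only [hpow]

theorem eLpNorm_le_of_bounded_of_forall_contDiff [μ.IsAddHaarMeasure] [p.HolderConjugate q]
    (hp : p ≠ ∞) {F f : V → ℝ} (hF : LocallyIntegrable F μ) (hf : AEStronglyMeasurable f μ)
    {M R : ℝ} (hfM : ∀ x, ‖f x‖ ≤ M) (hfR : ∀ x, R < ‖x‖ → f x = 0)
    (hfF : ∀ x, f x = 0 ∨ f x = F x)
    (h : ∀ g : V → ℝ, ContDiff ℝ (⊤ : ℕ∞) g → HasCompactSupport g →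
      ‖∫ x, g x * F x ∂μ‖ₑ ≤ B * eLpNorm g q μ) :
    eLpNorm f p μ ≤ B := by
  have hp_one : 1 ≤ p := ENNReal.HolderConjugate.one_le p q
  have hp_ne : p ≠ 0 := (zero_lt_one.trans_le hp_one).ne'
  have hp_real : 1 ≤ p.toReal := by simpa using ENNReal.toReal_mono hp hp_one
  have hfp : MemLp f p μ := memLp_of_bound_of_bounded_support hf hfM hfR
  set G : V → ℝ := fun x => |f x| ^ (p.toReal - 2) * f x
  have hG : AEStronglyMeasurable G μ :=
    ((hf.aemeasurable.abs.pow_const _).mul hf.aemeasurable).aestronglyMeasurable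
  have hGM (x : V) : ‖G x‖ ≤ M ^ (p.toReal - 1) :=
    (abs_rpow_sub_two_mul_le _ _).trans
      (Real.rpow_le_rpow (abs_nonneg _) (hfM x) (sub_nonneg.2 hp_real))
  have hGR (x : V) (hx : R < ‖x‖) : G x = 0 := by simp only [G, hfR x hx, mul_zero]
  have hbound : eLpNorm f p μ * eLpNorm f p μ ^ (p.toReal - 1) ≤
      B * eLpNorm f p μ ^ (p.toReal - 1) := by
    calc eLpNorm f p μ * eLpNorm f p μ ^ (p.toReal - 1)
        = ‖∫ x, G x * F x ∂μ‖ₑ := by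
          rw [enorm_integral_abs_rpow_sub_two_mul_mul hp_ne hp hfp hfF]
          conv_rhs => rw [← add_sub_cancel 1 p.toReal, ENNReal.rpow_add_of_nonneg _ _
            zero_le_one (sub_nonneg.2 hp_real), ENNReal.rpow_one]
      _ ≤ B * eLpNorm G q μ := enorm_integral_mul_le_of_forall_contDiff
          (ENNReal.HolderConjugate.one_le q p) hF hG hGM hGR h
      _ ≤ B * eLpNorm f p μ ^ (p.toReal - 1) := by
          gcongr
          exact eLpNorm_abs_rpow_sub_two_mul_le hp f
  rcases eq_or_ne (eLpNorm f p μ) 0 with hzero | hzero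
  · simp only [hzero, zero_le]
  · rwa [ENNReal.mul_le_mul_iff_left (ENNReal.rpow_pos (pos_iff_ne_zero.2 hzero) hfp.2.ne).ne'
      (ENNReal.rpow_ne_top_of_nonneg (sub_nonneg.2 hp_real) hfp.2.ne)] at hbound

theorem eLpNorm_le_of_forall_contDiff [μ.IsAddHaarMeasure] [p.HolderConjugate q] (hp : p ≠ ∞)
    {F : V → ℝ} (hF : LocallyIntegrable F μ)
    (h : ∀ g : V → ℝ, ContDiff ℝ (⊤ : ℕ∞) g → HasCompactSupport g →
      ‖∫ x, g x * F x ∂μ‖ₑ ≤ B * eLpNorm g q μ) :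
    eLpNorm F p μ ≤ B := by
  obtain ⟨F', hF'_meas, hFF'⟩ := hF.aestronglyMeasurable
  have hF' : LocallyIntegrable F' μ := (locallyIntegrable_congr hFF').1 hF
  have h' (g : V → ℝ) (hg : ContDiff ℝ (⊤ : ℕ∞) g) (hgc : HasCompactSupport g) :
      ‖∫ x, g x * F' x ∂μ‖ₑ ≤ B * eLpNorm g q μ := by
    have hae : (fun x => g x * F x) =ᵐ[μ] fun x => g x * F' x := by
      filter_upwards [hFF'] with x hx
      rw [hx]
    rw [← integral_congr_ae hae]
    exact h g hg hgc
  set s : ℕ → Set V := fun n => {x | ‖x‖ ≤ n ∧ ‖F' x‖ ≤ n}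
  have hs (n : ℕ) : MeasurableSet (s n) :=
    (measurableSet_le measurable_norm measurable_const).inter
      (measurableSet_le hF'_meas.measurable.norm measurable_const)
  have htrunc (n : ℕ) : eLpNorm ((s n).indicator F') p μ ≤ B := by
    refine eLpNorm_le_of_bounded_of_forall_contDiff (M := n) (R := n) hp hF'
      (hF'_meas.indicator (hs n)).aestronglyMeasurable (fun x => ?_)
      (fun x hx => Set.indicator_of_notMem (fun hxs => hx.not_ge hxs.1) _)
      (Set.indicator_eq_zero_or_self _ _) h'
    by_cases hx : x ∈ s n
    · rw [Set.indicator_of_mem hx]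
      exact hx.2
    · simp [Set.indicator_of_notMem hx]
  rw [eLpNorm_congr_ae hFF']
  refine Lp.eLpNorm_le_of_ae_tendsto (u := atTop) (Eventually.of_forall htrunc)
    (fun n => (hF'_meas.indicator (hs n)).aestronglyMeasurable) (Eventually.of_forall fun x => ?_)
  refine tendsto_const_nhds.congr' ?_
  filter_upwards [eventually_ge_atTop ⌈max ‖x‖ ‖F' x‖⌉₊] with n hn
  rw [Set.indicator_of_mem]
  exact max_le_iff.1 (Nat.ceil_le.1 hn)

theorem eLpNorm_le_two_mul_of_forall_contDiff [μ.IsAddHaarMeasure] [p.HolderConjugate q]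
    (hp : p ≠ ∞) {F : V → ℂ} (hF : LocallyIntegrable F μ)
    (h : ∀ g : V → ℝ, ContDiff ℝ (⊤ : ℕ∞) g → HasCompactSupport g →
      ‖∫ x, (g x : ℂ) * F x ∂μ‖ₑ ≤ B * eLpNorm g q μ) :
    eLpNorm F p μ ≤ 2 * B := by
  have hint (g : V → ℝ) (hg : ContDiff ℝ (⊤ : ℕ∞) g) (hgc : HasCompactSupport g) :
      Integrable (fun x => (g x : ℂ) * F x) μ :=
    hF.integrable_smul_left_of_hasCompactSupport (Complex.continuous_ofReal.comp hg.continuous)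
      (hgc.comp_left Complex.ofReal_zero)
  have hpart (L : ℂ →L[ℝ] ℝ) (hL : ∀ z, ‖L z‖ ≤ ‖z‖) : eLpNorm (fun x => L (F x)) p μ ≤ B := by
    refine eLpNorm_le_of_forall_contDiff hp (q := q) ?_ fun g hg hgc => ?_
    · exact hF.mono (L.continuous.comp_aestronglyMeasurable hF.aestronglyMeasurable)
        (Eventually.of_forall fun x => hL (F x))
    · have hcomm (x : V) : g x * L (F x) = L ((g x : ℂ) * F x) := by
        rw [← Complex.real_smul, map_smul, smul_eq_mul]
      simp only [hcomm]
      rw [L.integral_comp_comm (hint g hg hgc)]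
      exact (enorm_le_iff_norm_le.2 (hL _)).trans (h g hg hgc)
  exact eLpNorm_le_two_mul_of_re_of_im (ENNReal.HolderConjugate.one_le p q)
    hF.aestronglyMeasurable (hpart Complex.reCLM Complex.abs_re_le_norm)
    (hpart Complex.imCLM Complex.abs_im_le_norm)

end Duality

/-! ### Density of compactly supported functions -/

section Truncation

variable {V F : Type*} [NormedAddCommGroup V] [NormedSpace ℝ V] [NormedAddCommGroup F]
  [NormedSpace ℝ F]

theorem seminorm_le_of_eq_zero_on_ball {R : ℝ} (hR : 0 < R) {w : 𝓢(V, F)}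
    (hw : ∀ x, ‖x‖ < R → w x = 0) (a n : ℕ) :
    SchwartzMap.seminorm ℝ a n w ≤ R⁻¹ * SchwartzMap.seminorm ℝ (a + 1) n w := by
  refine SchwartzMap.seminorm_le_bound ℝ a n _ (by positivity) fun x => ?_
  rcases lt_or_ge ‖x‖ R with hx | hx
  · have hzero : ⇑w =ᶠ[𝓝 x] 0 := by
      filter_upwards [continuous_norm.continuousAt.eventually (gt_mem_nhds hx)] with y hy
      exact hw y hy
    rw [(hzero.iteratedFDeriv ℝ n).eq_of_nhds, show iteratedFDeriv ℝ n (0 : V → F) x = 0 from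
      congrFun iteratedFDeriv_fun_zero x, norm_zero, mul_zero]
    positivity
  · rw [le_inv_mul_iff₀ hR]
    calc R * (‖x‖ ^ a * ‖iteratedFDeriv ℝ n w x‖)
        ≤ ‖x‖ * (‖x‖ ^ a * ‖iteratedFDeriv ℝ n w x‖) := by gcongr
      _ = ‖x‖ ^ (a + 1) * ‖iteratedFDeriv ℝ n w x‖ := by ring
      _ ≤ SchwartzMap.seminorm ℝ (a + 1) n w := SchwartzMap.le_seminorm ℝ (a + 1) n w x

theorem tendsto_of_eqOn_ball {v : ℕ → 𝓢(V, F)} {u : 𝓢(V, F)}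
    (hbdd : ∀ a n, ∃ C, ∀ k, SchwartzMap.seminorm ℝ a n (v k) ≤ C)
    (heq : ∀ (k : ℕ) x, ‖x‖ < k + 1 → v k x = u x) : Tendsto v atTop (𝓝 u) := by
  rw [(schwartz_withSeminorms ℝ V F).tendsto_nhds]
  rintro ⟨a, n⟩ ε hε
  obtain ⟨C, hC⟩ := hbdd (a + 1) n
  have hbound (k : ℕ) : SchwartzMap.seminorm ℝ a n (v k - u) ≤
      1 / (k + 1) * (C + SchwartzMap.seminorm ℝ (a + 1) n u) := by
    rw [one_div]
    refine (seminorm_le_of_eq_zero_on_ball (R := k + 1) (by positivity) (fun x hx => ?_) a n).trans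
      (mul_le_mul_of_nonneg_left ?_ (by positivity))
    · rw [sub_apply, heq k x hx, sub_self]
    · exact (map_sub_le_add _ _ _).trans (by gcongr; exact hC k)
  have hlim := (tendsto_one_div_add_atTop_nhds_zero_nat (𝕜 := ℝ)).mul_const
    (C + SchwartzMap.seminorm ℝ (a + 1) n u)
  rw [zero_mul] at hlim
  filter_upwards [hlim.eventually (gt_mem_nhds hε)] with k hk
  exact (hbound k).trans_lt hk

theorem exists_seminorm_le_of_comp_smul_mul (η u : 𝓢(V, ℝ)) (a n : ℕ) :
    ∃ C, ∀ c : ℝ, ‖c‖ ≤ 1 → ∀ w : 𝓢(V, ℝ), (∀ x, w x = η (c • x) * u x) →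
      SchwartzMap.seminorm ℝ a n w ≤ C := by
  refine ⟨∑ i ∈ Finset.range (n + 1), (n.choose i : ℝ) * SchwartzMap.seminorm ℝ 0 i η *
    SchwartzMap.seminorm ℝ a (n - i) u, fun c hc w hw => ?_⟩
  have hη (i : ℕ) (x : V) :
      ‖iteratedFDeriv ℝ i (fun x => η (c • x)) x‖ ≤ SchwartzMap.seminorm ℝ 0 i η := by
    rw [iteratedFDeriv_comp_const_smul c (η.smooth i), norm_smul, norm_pow]
    exact (mul_le_of_le_one_left (norm_nonneg _) (pow_le_one₀ (norm_nonneg c) hc)).trans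
      (SchwartzMap.norm_iteratedFDeriv_le_seminorm ℝ η i _)
  refine SchwartzMap.seminorm_le_bound ℝ a n _
    (Finset.sum_nonneg fun i _ => by positivity) fun x => ?_
  calc ‖x‖ ^ a * ‖iteratedFDeriv ℝ n w x‖
      ≤ ‖x‖ ^ a * ∑ i ∈ Finset.range (n + 1), (n.choose i : ℝ) *
          ‖iteratedFDeriv ℝ i (fun x => η (c • x)) x‖ * ‖iteratedFDeriv ℝ (n - i) u x‖ := by
        rw [show ⇑w = fun x => η (c • x) * u x from funext hw]
        gcongr
        exact norm_iteratedFDeriv_mul_le ((η.smooth n).comp (contDiff_const_smul c)) (u.smooth n) x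
          le_rfl
    _ = ∑ i ∈ Finset.range (n + 1), (n.choose i : ℝ) *
          ‖iteratedFDeriv ℝ i (fun x => η (c • x)) x‖ *
            (‖x‖ ^ a * ‖iteratedFDeriv ℝ (n - i) u x‖) := by
        rw [Finset.mul_sum]
        exact Finset.sum_congr rfl fun i _ => by ring
    _ ≤ _ := by
        gcongr with i
        · exact hη i x
        · exact SchwartzMap.le_seminorm ℝ a (n - i) u x

theorem exists_hasCompactSupport_tendsto [FiniteDimensional ℝ V] (u : 𝓢(V, ℝ)) :
    ∃ v : ℕ → 𝓢(V, ℝ), (∀ k, HasCompactSupport (v k)) ∧ Tendsto v atTop (𝓝 u) := by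
  let φ : ContDiffBump (0 : V) := ⟨1, 2, zero_lt_one, one_lt_two⟩
  let η : 𝓢(V, ℝ) := φ.hasCompactSupport.toSchwartzMap φ.contDiff
  have hc (k : ℕ) : ((k : ℝ) + 1)⁻¹ ≠ 0 := by positivity
  have hnorm (k : ℕ) : ‖((k : ℝ) + 1)⁻¹‖ = ((k : ℝ) + 1)⁻¹ :=
    Real.norm_of_nonneg (by positivity)
  have hsupp (k : ℕ) : HasCompactSupport fun x => η (((k : ℝ) + 1)⁻¹ • x) * u x :=
    (φ.hasCompactSupport.comp_smul (hc k)).mul_right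
  refine ⟨fun k => (hsupp k).toSchwartzMap
    (((η.smooth _).comp (contDiff_const_smul _)).mul (u.smooth _)), hsupp,
    tendsto_of_eqOn_ball (fun a n => ?_) fun k x hx => ?_⟩
  · obtain ⟨C, hC⟩ := exists_seminorm_le_of_comp_smul_mul η u a n
    refine ⟨C, fun k => hC _ ?_ _ fun x => rfl⟩
    rw [hnorm]
    exact inv_le_one_of_one_le₀ (by simp)
  · have hone : η (((k : ℝ) + 1)⁻¹ • x) = 1 := φ.one_of_mem_closedBall (by
      rw [mem_closedBall_zero_iff, norm_smul, hnorm, inv_mul_le_iff₀ (by positivity), mul_one]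
      exact hx.le)
    exact (congrArg (· * u x) hone).trans (one_mul _)

theorem tendsto_eLpNorm_schwartz [MeasurableSpace V] [BorelSpace V] [SecondCountableTopology V]
    {μ : Measure V} [μ.HasTemperateGrowth] {p : ℝ≥0∞} (hp : 1 ≤ p) {ι : Type*} {l : Filter ι}
    {v : ι → 𝓢(V, F)} (hv : Tendsto v l (𝓝 0)) :
    Tendsto (fun k => eLpNorm (v k) p μ) l (𝓝 0) := by
  have : Fact (1 ≤ p) := ⟨hp⟩
  have hlim := ((SchwartzMap.continuous_toLp (p := p) (μ := μ)).tendsto (0 : 𝓢(V, F))).comp hv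
  have hnorm (k : ι) : ‖(v k).toLp p μ‖ₑ = eLpNorm (v k) p μ := by
    rw [Lp.enorm_def, eLpNorm_congr_ae ((v k).coeFn_toLp p μ)]
  rw [← SchwartzMap.toLpCLM_apply (𝕜 := ℝ), map_zero] at hlim
  simpa only [Function.comp_def, hnorm, enorm_zero] using hlim.enorm

end Truncation

section BesovContinuity

namespace Cutoff

/-- The symbol `ξ ↦ profile ξ / ‖ξ‖^{2N}`: dividing by powers of the symbol `‖ξ‖²` of `-Δ` trades
smoothness for decay of the Littlewood–Paley blocks. -/
def profileDiv (χ : Cutoff d) (N : ℕ) (ξ : E d) : ℂ := χ.profile ξ / ((‖ξ‖ ^ 2) ^ N : ℝ)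

theorem contDiff_profileDiv (χ : Cutoff d) (N : ℕ) : ContDiff ℝ (⊤ : ℕ∞) (χ.profileDiv N) := by
  refine contDiff_div_of_ne_zero_on_tsupport χ.contDiff_profile
    (Complex.ofRealCLM.contDiff.comp ((contDiff_norm_sq ℝ).pow N)) fun ξ hξ => ?_
  have hξ_ne : ξ ≠ 0 := fun h => χ.zero_notMem_tsupport_profile (h ▸ hξ)
  exact Complex.ofReal_ne_zero.2 (by positivity)

theorem hasCompactSupport_profileDiv (χ : Cutoff d) (N : ℕ) :
    HasCompactSupport (χ.profileDiv N) :=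
  hasCompactSupport_of_eq_zero (R := 2) fun ξ hξ => by
    rw [profileDiv, χ.profile_eq_zero_of_le_norm hξ, zero_div]

theorem profile_eq_profileDiv_mul (χ : Cutoff d) (N : ℕ) (ξ : E d) :
    χ.profile ξ = χ.profileDiv N ξ * ((‖ξ‖ ^ 2) ^ N : ℝ) := by
  rcases eq_or_ne ξ 0 with rfl | hξ
  · have hzero : χ.profile (0 : E d) = 0 := χ.profile_eq_zero_of_norm_le (by simp)
    rw [profileDiv, hzero, zero_div, zero_mul]
  · exact (div_mul_cancel₀ _ (Complex.ofReal_ne_zero.2 (by positivity))).symm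

theorem blockCLM_succ_eq_smul (χ : Cutoff d) (n N : ℕ) (φ : 𝓢(E d, ℂ)) :
    χ.blockCLM (n + 1) φ = (((((2 : ℝ) ^ (n + 1))⁻¹ ^ 2) ^ N : ℝ) : ℂ) •
      SchwartzMap.fourierMultiplierCLM ℂ (fun ξ => χ.profileDiv N (((2 : ℝ) ^ (n + 1))⁻¹ • ξ))
        (SchwartzMap.fourierMultiplierCLM ℂ (fun ξ : E d => (((‖ξ‖ ^ 2) ^ N : ℝ) : ℂ)) φ) := by
  set c : ℝ := ((2 : ℝ) ^ (n + 1))⁻¹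
  have hgrowth : (fun ξ : E d => (((‖ξ‖ ^ 2) ^ N : ℝ) : ℂ)).HasTemperateGrowth := by
    simp only [Complex.ofReal_pow _ N]
    fun_prop
  have hgrowth' : (fun ξ => χ.profileDiv N (c • ξ)).HasTemperateGrowth :=
    ((χ.hasCompactSupport_profileDiv N).comp_smul (by positivity)).hasTemperateGrowth
      ((χ.contDiff_profileDiv N).comp (contDiff_const_smul c))
  refine ext_fourier fun ξ => ?_
  rw [fourier_blockCLM, FourierTransform.fourier_smul, smul_apply,
    fourier_fourierMultiplierCLM hgrowth', fourier_fourierMultiplierCLM hgrowth, smul_eq_mul,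
    show (χ.symbol (n + 1) ξ : ℂ) = χ.profile (c • ξ) from congrFun (χ.symbol_succ n) ξ,
    χ.profile_eq_profileDiv_mul N, norm_smul, Real.norm_of_nonneg (by positivity)]
  push_cast
  ring

theorem eLpNorm_blockCLM_succ_le (χ : Cutoff d) (n N : ℕ) (φ : 𝓢(E d, ℂ)) {r : ℝ≥0∞}
    (hr : 1 ≤ r) :
    eLpNorm (χ.blockCLM (n + 1) φ) r volume ≤ 2 ^ (-(((n + 1 : ℕ) : ℝ) * (2 * N))) *
      ((∫⁻ x, ‖𝓕⁻ (χ.profileDiv N) x‖ₑ) * eLpNorm (SchwartzMap.fourierMultiplierCLM ℂ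
        (fun ξ : E d => (((‖ξ‖ ^ 2) ^ N : ℝ) : ℂ)) φ) r volume) := by
  have hscale : ‖(((((2 : ℝ) ^ (n + 1))⁻¹ ^ 2) ^ N : ℝ) : ℂ)‖ₑ =
      2 ^ (-(((n + 1 : ℕ) : ℝ) * (2 * N))) := by
    rw [← ofReal_norm, Complex.norm_real, Real.norm_of_nonneg (by positivity), inv_pow, inv_pow,
      ← pow_mul, ← pow_mul, ENNReal.rpow_neg, ENNReal.ofReal_inv_of_pos (by positivity),
      ENNReal.ofReal_pow zero_le_two, ENNReal.ofReal_ofNat, ← ENNReal.rpow_natCast]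
    push_cast
    rfl
  rw [blockCLM_succ_eq_smul χ n N, FunLike.coe_smul, eLpNorm_const_smul, hscale]
  gcongr
  exact eLpNorm_fourierMultiplierCLM_comp_smul_le (χ.contDiff_profileDiv N)
    (χ.hasCompactSupport_profileDiv N) (by positivity) _ hr

end Cutoff

theorem exists_besovNorm_one_le (χ : Cutoff d) (α : ℝ) {r : ℝ≥0∞} (hr : 1 ≤ r) :
    ∃ (C : ℝ≥0∞) (L : 𝓢(E d, ℂ) →L[ℂ] 𝓢(E d, ℂ)), C ≠ ∞ ∧ ∀ u : 𝓢(E d, ℝ),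
      besovNorm χ α r 1 u ≤
        χ.mass * eLpNorm u r volume + C * eLpNorm (L (schwartzOfReal u)) r volume := by
  obtain ⟨N, hN⟩ := exists_nat_gt α
  have hgain : 0 < 2 * N - α := by linarith [(Nat.cast_nonneg N : (0 : ℝ) ≤ N)]
  set G : ℝ≥0∞ := ∑' n : ℕ, (2 : ℝ≥0∞) ^ (-((n : ℝ) * (2 * N - α)))
  set I : ℝ≥0∞ := ∫⁻ x, ‖𝓕⁻ (χ.profileDiv N) x‖ₑ
  set L : 𝓢(E d, ℂ) →L[ℂ] 𝓢(E d, ℂ) :=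
    SchwartzMap.fourierMultiplierCLM ℂ fun ξ : E d => (((‖ξ‖ ^ 2) ^ N : ℝ) : ℂ)
  have hI : I ≠ ∞ := (lintegral_enorm_fourierInv_lt_top (χ.contDiff_profileDiv N)
    (χ.hasCompactSupport_profileDiv N)).ne
  refine ⟨G * I, L, ENNReal.mul_ne_top (tsum_two_rpow_neg_ne_top hgain) hI, fun u => ?_⟩
  have hsucc (n : ℕ) : 2 ^ (((n + 1 : ℕ) : ℝ) * α) * eLpNorm (χ.block (n + 1) u) r volume ≤
      2 ^ (-(((n + 1 : ℕ) : ℝ) * (2 * N - α))) *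
        (I * eLpNorm (L (schwartzOfReal u)) r volume) := by
    rw [χ.block_schwartz, show -(((n + 1 : ℕ) : ℝ) * (2 * N - α)) =
      ((n + 1 : ℕ) : ℝ) * α + -(((n + 1 : ℕ) : ℝ) * (2 * N)) by ring, two_rpow_add, mul_assoc]
    gcongr
    exact χ.eLpNorm_blockCLM_succ_le n N _ hr
  rw [besovNorm_one, tsum_eq_zero_add' ENNReal.summable]
  refine add_le_add ?_ ((ENNReal.tsum_le_tsum hsucc).trans ?_)
  · simpa using χ.eLpNorm_block_le 0 u.continuous.aestronglyMeasurable hr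
  · rw [ENNReal.tsum_mul_right, mul_assoc]
    gcongr
    exact ENNReal.tsum_comp_le_tsum_of_injective (add_left_injective 1)
      fun n : ℕ => (2 : ℝ≥0∞) ^ (-((n : ℝ) * (2 * N - α)))

theorem tendsto_besovNorm_one (χ : Cutoff d) (α : ℝ) {r : ℝ≥0∞} (hr : 1 ≤ r)
    {v : ℕ → 𝓢(E d, ℝ)} (hv : Tendsto v atTop (𝓝 0)) :
    Tendsto (fun k => besovNorm χ α r 1 (v k)) atTop (𝓝 0) := by
  obtain ⟨C, L, hC, hbound⟩ := exists_besovNorm_one_le χ α hr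
  have hLv : Tendsto (fun k => L (schwartzOfReal (v k))) atTop (𝓝 0) := by
    simpa only [Function.comp_def, map_zero] using
      ((L.continuous.comp schwartzOfReal.continuous).tendsto 0).comp hv
  have hlim := (ENNReal.Tendsto.const_mul (tendsto_eLpNorm_schwartz (μ := volume) hr hv)
    (Or.inr χ.mass_ne_top)).add (ENNReal.Tendsto.const_mul
      (tendsto_eLpNorm_schwartz (μ := volume) hr hLv) (Or.inr hC))
  rw [mul_zero, mul_zero, add_zero] at hlim
  exact tendsto_of_tendsto_of_tendsto_of_le_of_le tendsto_const_nhds hlim (fun _ => zero_le)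
    fun k => hbound (v k)

theorem Cutoff.continuous_block_schwartz (χ : Cutoff d) (n : ℕ) (u : 𝓢(E d, ℝ)) :
    Continuous (χ.block n u) :=
  χ.block_schwartz n u ▸ SchwartzMap.continuous _

theorem Cutoff.block_add (χ : Cutoff d) (n : ℕ) (u v : 𝓢(E d, ℝ)) :
    χ.block n (u + v : 𝓢(E d, ℝ)) = χ.block n u + χ.block n v := by
  simp only [χ.block_schwartz, map_add]
  rfl

theorem besovNorm_one_add_le (χ : Cutoff d) (α : ℝ) {r : ℝ≥0∞} (hr : 1 ≤ r) (u v : 𝓢(E d, ℝ)) :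
    besovNorm χ α r 1 (u + v : 𝓢(E d, ℝ)) ≤ besovNorm χ α r 1 u + besovNorm χ α r 1 v := by
  rw [besovNorm_one, besovNorm_one, besovNorm_one, ← ENNReal.tsum_add]
  refine ENNReal.tsum_le_tsum fun n => ?_
  rw [← mul_add, χ.block_add]
  gcongr
  exact eLpNorm_add_le (χ.continuous_block_schwartz n u).aestronglyMeasurable
    (χ.continuous_block_schwartz n v).aestronglyMeasurable hr

end BesovContinuity

/-! ### Blocks of weighted measures -/

namespace Cutoff

/-- The cut-off `ξ ↦ χ(-ξ)`. Its Littlewood–Paley blocks are the transposes of those of `χ`. -/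
def reflect (χ : Cutoff d) : Cutoff d where
  toFun ξ := χ.toFun (-ξ)
  smooth := χ.smooth.comp contDiff_neg
  eq_one ξ hξ := χ.eq_one _ (by rwa [norm_neg])
  eq_zero ξ hξ := χ.eq_zero _ (by rwa [norm_neg])

theorem symbol_reflect (χ : Cutoff d) (n : ℕ) (ξ : E d) :
    χ.reflect.symbol n ξ = χ.symbol n (-ξ) := by
  cases n <;> simp only [symbol, reflect, smul_neg]

theorem kernel_reflect (χ : Cutoff d) (n : ℕ) (x : E d) :
    χ.reflect.kernel n x = χ.kernel n (-x) := by
  simp only [kernel, symbol_reflect]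
  exact Real.fourierInv_comp_linearIsometry (LinearIsometryEquiv.neg ℝ)
    (fun ξ : E d => (χ.symbol n ξ : ℂ)) x

theorem blockCLM_reflect_apply (χ : Cutoff d) (n : ℕ) (φ : 𝓢(E d, ℂ)) (t : E d) :
    χ.reflect.blockCLM n φ t = ∫ x, φ x * χ.kernel n (x - t) := by
  simp only [blockCLM_apply, kernel_reflect, neg_sub]

end Cutoff

section WeightedBlocks

/-- The weighted measure `w ν` is translation bounded, tested against Schwartz functions. Functions
in `L^p` (with `ν` the Lebesgue measure) and finite measures (with `w = 1`) both have this property,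
which makes `φ ↦ ∫ φ w ∂ν` a functional on the Schwartz space with bounded mollifications. -/
structure IsTranslationBounded (ν : Measure (E d)) (w : E d → ℝ) : Prop where
  aestronglyMeasurable : AEStronglyMeasurable w ν
  exists_lintegral_le : ∀ φ : 𝓢(E d, ℂ), ∃ B : ℝ≥0∞, B ≠ ∞ ∧
    ∀ x, ∫⁻ t, ‖w t‖ₑ * ‖φ (t - x)‖ₑ ∂ν ≤ B

/-- The Littlewood–Paley block `𝓕⁻¹ φₙ ⋆ (w ν)` of a weighted measure. -/
def Cutoff.weightedBlock (χ : Cutoff d) (n : ℕ) (ν : Measure (E d)) (w : E d → ℝ) (x : E d) : ℂ :=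
  ∫ t, (w t : ℂ) * χ.kernel n (x - t) ∂ν

theorem Cutoff.weightedBlock_volume (χ : Cutoff d) (n : ℕ) (f : E d → ℝ) :
    χ.weightedBlock n volume f = χ.block n f := rfl

variable {ν : Measure (E d)} {w : E d → ℝ}

theorem lintegral_enorm_mul_enorm_le {Ω F : Type*} [MeasurableSpace Ω] {μ : Measure Ω}
    [NormedAddCommGroup F] [NormedSpace ℝ F] {p q : ℝ≥0∞} [p.HolderConjugate q] {f : Ω → ℝ}
    {g : Ω → F} (hf : AEStronglyMeasurable f μ) (hg : AEStronglyMeasurable g μ) :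
    ∫⁻ x, ‖f x‖ₑ * ‖g x‖ₑ ∂μ ≤ eLpNorm f p μ * eLpNorm g q μ := by
  simpa only [eLpNorm_one_eq_lintegral_enorm, Pi.smul_apply', enorm_smul] using
    eLpNorm_smul_le_mul_eLpNorm (r := 1) hg hf

theorem isTranslationBounded_of_memLp {p q : ℝ≥0∞} [p.HolderConjugate q] {f : E d → ℝ}
    (hf : MemLp f p volume) : IsTranslationBounded volume f where
  aestronglyMeasurable := hf.1
  exists_lintegral_le φ := by
    refine ⟨eLpNorm f p volume * eLpNorm φ q volume,
      ENNReal.mul_ne_top hf.2.ne (φ.memLp q volume).2.ne, fun x => ?_⟩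
    have hshift := measurePreserving_sub_right (volume : Measure (E d)) x
    have hφ : AEStronglyMeasurable (fun t => φ (t - x)) volume :=
      (φ.continuous.comp (continuous_sub_right x)).aestronglyMeasurable
    rw [← eLpNorm_comp_measurePreserving φ.continuous.aestronglyMeasurable hshift]
    exact lintegral_enorm_mul_enorm_le hf.1 hφ

theorem isTranslationBounded_one (ν : Measure (E d)) [IsFiniteMeasure ν] :
    IsTranslationBounded ν 1 where
  aestronglyMeasurable := aestronglyMeasurable_one
  exists_lintegral_le φ := by
    refine ⟨∫⁻ _, ENNReal.ofReal (SchwartzMap.seminorm ℝ 0 0 φ) ∂ν, ?_, fun x =>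
      lintegral_mono fun t => ?_⟩
    · rw [lintegral_const]
      finiteness
    · rw [Pi.one_apply, enorm_one, one_mul, ← ofReal_norm]
      exact ENNReal.ofReal_le_ofReal (SchwartzMap.norm_le_seminorm ℝ φ _)

theorem enorm_complex_ofReal (x : ℝ) : ‖(x : ℂ)‖ₑ = ‖x‖ₑ := by
  rw [← ofReal_norm, Complex.norm_real, ofReal_norm]

namespace IsTranslationBounded

theorem integrable_mul (hw : IsTranslationBounded ν w) (φ : 𝓢(E d, ℂ)) :
    Integrable (fun t => (w t : ℂ) * φ t) ν := by
  refine ⟨(Complex.continuous_ofReal.comp_aestronglyMeasurable hw.aestronglyMeasurable).mul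
    φ.continuous.aestronglyMeasurable, ?_⟩
  obtain ⟨B, hB, hφ⟩ := hw.exists_lintegral_le φ
  refine lt_of_le_of_lt ?_ hB.lt_top
  simpa only [enorm_mul, enorm_complex_ofReal, sub_zero] using hφ 0

/-- The functional `φ ↦ ∫ φ w ∂ν` on the Schwartz space. -/
def functional (hw : IsTranslationBounded ν w) : 𝓢(E d, ℂ) →ₗ[ℂ] ℂ where
  toFun φ := ∫ t, (w t : ℂ) * φ t ∂ν
  map_add' φ ψ := by
    rw [← integral_add (hw.integrable_mul φ) (hw.integrable_mul ψ)]
    simp only [add_apply, mul_add]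
  map_smul' c φ := by
    rw [RingHom.id_apply, smul_eq_mul, ← integral_const_mul]
    simp only [smul_apply, smul_eq_mul, mul_left_comm]

theorem functional_schwartzOfReal (hw : IsTranslationBounded ν w) (u : 𝓢(E d, ℝ)) :
    hw.functional (schwartzOfReal u) = (∫ t, w t * u t ∂ν : ℝ) := by
  rw [← integral_complex_ofReal]
  simp only [functional, LinearMap.coe_mk, AddHom.coe_mk, schwartzOfReal_apply, Complex.ofReal_mul]

theorem exists_lintegral_kernel_le (hw : IsTranslationBounded ν w) (χ : Cutoff d) (n : ℕ) :
    ∃ B : ℝ≥0∞, B ≠ ∞ ∧ ∀ x, ∫⁻ t, ‖w t‖ₑ * ‖χ.kernel n (x - t)‖ₑ ∂ν ≤ B := by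
  simpa only [χ.reflect.coe_fourierInv_schwartzSymbol, χ.kernel_reflect, neg_sub] using
    hw.exists_lintegral_le (𝓕⁻ (χ.reflect.schwartzSymbol n))

theorem aestronglyMeasurable_mul_kernel (hw : IsTranslationBounded ν w) [SFinite ν] (χ : Cutoff d)
    (n : ℕ) : AEStronglyMeasurable (fun z : E d × E d => (w z.2 : ℂ) * χ.kernel n (z.1 - z.2))
      (volume.prod ν) :=
  (Complex.continuous_ofReal.comp_aestronglyMeasurable hw.aestronglyMeasurable).comp_snd.mul
    ((χ.continuous_kernel n).comp (continuous_fst.sub continuous_snd)).aestronglyMeasurable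

theorem integrable_prod (hw : IsTranslationBounded ν w) [SFinite ν] (χ : Cutoff d) (n : ℕ)
    (g : 𝓢(E d, ℂ)) :
    Integrable (fun z : E d × E d => g z.1 * ((w z.2 : ℂ) * χ.kernel n (z.1 - z.2)))
      (volume.prod ν) := by
  obtain ⟨B, hB, hkernel⟩ := hw.exists_lintegral_kernel_le χ n
  have hmeas : AEStronglyMeasurable
      (fun z : E d × E d => g z.1 * ((w z.2 : ℂ) * χ.kernel n (z.1 - z.2))) (volume.prod ν) :=
    (g.continuous.comp continuous_fst).aestronglyMeasurable.mul
      (hw.aestronglyMeasurable_mul_kernel χ n)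
  refine ⟨hmeas, ?_⟩
  calc ∫⁻ z, ‖g z.1 * ((w z.2 : ℂ) * χ.kernel n (z.1 - z.2))‖ₑ ∂(volume.prod ν)
      = ∫⁻ x, ‖g x‖ₑ * ∫⁻ t, ‖w t‖ₑ * ‖χ.kernel n (x - t)‖ₑ ∂ν := by
        rw [lintegral_prod _ hmeas.enorm]
        simp only [enorm_mul, enorm_complex_ofReal]
        exact lintegral_congr fun x => lintegral_const_mul' _ _ enorm_ne_top
    _ ≤ ∫⁻ x, ‖g x‖ₑ * B := by gcongr with x; exact hkernel x
    _ < ∞ := by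
        rw [lintegral_mul_const' _ _ hB]
        exact ENNReal.mul_lt_top g.integrable.2 hB.lt_top

theorem locallyIntegrable_weightedBlock (hw : IsTranslationBounded ν w) [SFinite ν] (χ : Cutoff d)
    (n : ℕ) : LocallyIntegrable (χ.weightedBlock n ν w) volume := by
  obtain ⟨B, hB, hkernel⟩ := hw.exists_lintegral_kernel_le χ n
  have hbound (x : E d) : ‖χ.weightedBlock n ν w x‖ ≤ B.toReal := by
    rw [← toReal_enorm]
    refine ENNReal.toReal_mono hB ((enorm_integral_le_lintegral_enorm _).trans ?_)
    simpa only [enorm_mul, enorm_complex_ofReal] using hkernel x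
  exact (memLp_top_of_bound (hw.aestronglyMeasurable_mul_kernel χ n).integral_prod_right' B.toReal
    (Eventually.of_forall hbound)).locallyIntegrable le_top

theorem integral_mul_weightedBlock (hw : IsTranslationBounded ν w) [SFinite ν] (χ : Cutoff d)
    (n : ℕ) (g : 𝓢(E d, ℂ)) :
    ∫ x, g x * χ.weightedBlock n ν w x = hw.functional (χ.reflect.blockCLM n g) := by
  calc ∫ x, g x * χ.weightedBlock n ν w x
      = ∫ x, ∫ t, g x * ((w t : ℂ) * χ.kernel n (x - t)) ∂ν := by
        simp only [Cutoff.weightedBlock, integral_const_mul]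
    _ = ∫ t, (∫ x, g x * ((w t : ℂ) * χ.kernel n (x - t))) ∂ν :=
        integral_integral_swap (hw.integrable_prod χ n g)
    _ = ∫ t, (w t : ℂ) * χ.reflect.blockCLM n g t ∂ν := by
        simp only [χ.blockCLM_reflect_apply, mul_left_comm, integral_const_mul]

end IsTranslationBounded

theorem exists_eLpNorm_weightedBlock_succ_le (χ : Cutoff d) (m : ℕ) (s : ℝ) {α : ℝ} (hα : 0 < α)
    {p q : ℝ≥0∞} [p.HolderConjugate q] (hp : p ≠ ∞) :
    ∃ C : ℝ≥0∞, C ≠ ∞ ∧ ∀ (ν : Measure (E d)) [SFinite ν] (w : E d → ℝ)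
      (hw : IsTranslationBounded ν w) (K : ℝ≥0∞), GainsOnDifferences χ m s α q K hw.functional →
      ∀ n : ℕ, eLpNorm (χ.weightedBlock (n + 1) ν w) p volume ≤
        C * K * 2 ^ (-(((n + 1 : ℕ) : ℝ) * (s - α))) := by
  have : q.HolderConjugate p := ENNReal.HolderConjugate.symm
  obtain ⟨C, hC, hgain⟩ := exists_enorm_blockCLM_succ_le χ χ.reflect m s hα
    (ENNReal.HolderConjugate.one_le q p)
  refine ⟨2 * C, by finiteness, fun ν _ w hw K hT n => ?_⟩
  rw [mul_assoc, mul_assoc]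
  refine eLpNorm_le_two_mul_of_forall_contDiff (q := q) hp
    (hw.locallyIntegrable_weightedBlock χ (n + 1)) fun g hg hgc => ?_
  let u : 𝓢(E d, ℝ) := hgc.toSchwartzMap hg
  calc ‖∫ x, (g x : ℂ) * χ.weightedBlock (n + 1) ν w x‖ₑ
      = ‖hw.functional (χ.reflect.blockCLM (n + 1) (schwartzOfReal u))‖ₑ := by
        rw [← hw.integral_mul_weightedBlock]
        rfl
    _ ≤ C * (K * 2 ^ (-(((n + 1 : ℕ) : ℝ) * (s - α))) *
          eLpNorm (schwartzOfReal u) q volume) := hgain _ _ hT n _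
    _ = C * (K * 2 ^ (-(((n + 1 : ℕ) : ℝ) * (s - α)))) * eLpNorm g q volume := by
        rw [mul_assoc C]
        congr 2
        exact eLpNorm_congr_norm_ae (Eventually.of_forall fun x => Complex.norm_real (g x))

end WeightedBlocks

section Functions

variable {p q : ℝ≥0∞} {f : E d → ℝ}

theorem IsTranslationBounded.continuous_functional (hw : IsTranslationBounded volume f)
    (hp : 1 ≤ p) (hf : MemLp f p volume) : Continuous hw.functional := by
  have : p.HolderConjugate p.conjExponent := .conjExponent hp
  have hq : 1 ≤ p.conjExponent := ENNReal.HolderConjugate.one_le p.conjExponent p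
  refine continuous_of_continuousAt_zero hw.functional ?_
  rw [ContinuousAt, map_zero, tendsto_zero_iff_enorm_tendsto_zero]
  have hlim := ENNReal.Tendsto.const_mul
    (tendsto_eLpNorm_schwartz (μ := volume) hq (v := fun φ : 𝓢(E d, ℂ) => φ) tendsto_id)
    (Or.inr hf.2.ne)
  rw [mul_zero] at hlim
  refine tendsto_of_tendsto_of_tendsto_of_le_of_le tendsto_const_nhds hlim (fun _ => zero_le)
    fun φ => (enorm_integral_le_lintegral_enorm _).trans ?_
  simpa only [enorm_mul, enorm_complex_ofReal] using
    lintegral_enorm_mul_enorm_le hf.1 φ.continuous.aestronglyMeasurable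

theorem gainsOnDifferences_of_forall_contDiff {χ : Cutoff d} {m : ℕ} {s α : ℝ} (hs : 0 ≤ s)
    (hq : 1 ≤ q) (hq_top : q ≠ ∞) {K : ℝ≥0∞} (hK : K ≠ ∞) (hw : IsTranslationBounded volume f)
    (hcont : Continuous hw.functional)
    (h : ∀ φ : E d → ℝ, ContDiff ℝ (⊤ : ℕ∞) φ → HasCompactSupport φ → ∀ h : E d, ‖h‖ ≤ 1 →
      ‖∫ x, ((fwdDiff h)^[m] φ) x * f x‖ₑ ≤ K * ‖h‖ₑ ^ s * triebelLizorkinNorm χ α q ∞ φ) :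
    GainsOnDifferences χ m s α q K hw.functional := by
  intro u y hy
  obtain ⟨v, hvc, hv⟩ := exists_hasCompactSupport_tendsto u
  have hsub : Tendsto (fun k => v k - u) atTop (𝓝 0) := sub_self u ▸ hv.sub_const u
  have hleft : Tendsto (fun k => hw.functional (schwartzOfReal ((schwartzDiff y)^[m] (v k)))) atTop
      (𝓝 (hw.functional (schwartzOfReal ((schwartzDiff y)^[m] u)))) :=
    ((hcont.comp (schwartzOfReal.continuous.comp
      ((schwartzDiff y).continuous.iterate m))).tendsto u).comp hv
  have hright : Tendsto (fun k => K * ‖y‖ₑ ^ s * (besovNorm χ α q 1 (v k - u : 𝓢(E d, ℝ)) +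
      besovNorm χ α q 1 u)) atTop (𝓝 (K * ‖y‖ₑ ^ s * besovNorm χ α q 1 u)) := by
    simpa only [zero_add] using ENNReal.Tendsto.const_mul
      ((tendsto_besovNorm_one χ α hq hsub).add_const (besovNorm χ α q 1 u))
      (Or.inr (by finiteness))
  refine le_of_tendsto_of_tendsto' hleft.enorm hright fun k => ?_
  calc ‖hw.functional (schwartzOfReal ((schwartzDiff y)^[m] (v k)))‖ₑ
      = ‖∫ x, ((fwdDiff y)^[m] (v k)) x * f x‖ₑ := by
        rw [hw.functional_schwartzOfReal, enorm_complex_ofReal, coe_schwartzDiff_iterate]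
        simp only [mul_comm]
    _ ≤ K * ‖y‖ₑ ^ s * triebelLizorkinNorm χ α q ∞ (v k) :=
        h _ ((v k).smooth ⊤) (hvc k) y hy
    _ ≤ K * ‖y‖ₑ ^ s * besovNorm χ α q 1 (v k) := by
        gcongr
        exact triebelLizorkinNorm_top_le_besovNorm_one χ α hq hq_top fun n =>
          (χ.continuous_block_schwartz n (v k)).aestronglyMeasurable
    _ ≤ K * ‖y‖ₑ ^ s * (besovNorm χ α q 1 (v k - u : 𝓢(E d, ℝ)) + besovNorm χ α q 1 u) := by
        gcongr
        simpa only [sub_add_cancel] using besovNorm_one_add_le χ α hq (v k - u) u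

theorem besovNorm_top_le_of_forall {χ : Cutoff d} {σ : ℝ} {B : ℝ≥0∞}
    (h : ∀ n : ℕ, eLpNorm (χ.block n f) p volume ≤ B * 2 ^ (-((n : ℝ) * σ))) :
    besovNorm χ σ p ∞ f ≤ B :=
  eLpNorm_top_count_le fun n => by
    calc 2 ^ ((n : ℝ) * σ) * eLpNorm (χ.block n f) p volume
        ≤ 2 ^ ((n : ℝ) * σ) * (B * 2 ^ (-((n : ℝ) * σ))) := by gcongr; exact h n
      _ = B := by rw [mul_left_comm, ← two_rpow_add, add_neg_cancel, ENNReal.rpow_zero, mul_one]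

theorem exists_le_ofReal {C : ℝ≥0∞} (hC : C ≠ ∞) : ∃ c : ℝ, 0 < c ∧ C ≤ ENNReal.ofReal c :=
  ⟨C.toReal + 1, by positivity, (ENNReal.le_ofReal_iff_toReal_le hC (by positivity)).2 (by simp)⟩

theorem exists_besovNorm_top_le [p.HolderConjugate q] (χ : Cutoff d) (m : ℕ) (s : ℝ) {α : ℝ}
    (hα : 0 < α) (hp : p ≠ ∞) :
    ∃ C : ℝ, 0 < C ∧ ∀ (f : E d → ℝ) (_ : MemLp f p volume)
      (hw : IsTranslationBounded volume f) (K : ℝ≥0∞),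
      GainsOnDifferences χ m s α q K hw.functional →
      besovNorm χ (s - α) p ∞ f ≤ ENNReal.ofReal C * (eLpNorm f p volume + K) := by
  obtain ⟨C, hC, hblocks⟩ := exists_eLpNorm_weightedBlock_succ_le (q := q) χ m s hα hp
  obtain ⟨c, hc, hCc⟩ := exists_le_ofReal (ENNReal.add_ne_top.2 ⟨χ.mass_ne_top, hC⟩)
  refine ⟨c, hc, fun f hf hw K hT => (besovNorm_top_le_of_forall fun n => ?_).trans
    (mul_le_mul_left hCc _)⟩
  cases n with
  | zero =>
    rw [Nat.cast_zero, zero_mul, neg_zero, ENNReal.rpow_zero, mul_one]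
    exact (χ.eLpNorm_block_le 0 hf.1 (ENNReal.HolderConjugate.one_le p q)).trans
      (mul_le_mul' le_self_add le_self_add)
  | succ n =>
    rw [← χ.weightedBlock_volume]
    refine (hblocks volume f hw K hT n).trans ?_
    gcongr
    exacts [le_add_self, le_add_self]

end Functions

/-! ### Absolute continuity -/

section AbsoluteContinuity

theorem exists_contDiff_eq_one_on_eq_zero_off {V : Type*} [NormedAddCommGroup V] [NormedSpace ℝ V]
    [FiniteDimensional ℝ V] {L U : Set V} (hL : IsCompact L) (hU : IsOpen U) (hLU : L ⊆ U) :
    ∃ g : V → ℝ, ContDiff ℝ (⊤ : ℕ∞) g ∧ HasCompactSupport g ∧ (∀ x, g x ∈ Set.Icc 0 1) ∧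
      (∀ x ∈ L, g x = 1) ∧ ∀ x ∉ U, g x = 0 := by
  obtain ⟨W, hW, hLW, hWU, hWc⟩ := exists_open_between_and_isCompact_closure hL hU hLU
  obtain ⟨g, hg, hrange, hsupp, hone⟩ :=
    exists_contMDiff_support_eq_eq_one_iff (n := (⊤ : ℕ∞)) (modelWithCornersSelf ℝ V) hW hL.isClosed
      hLW
  refine ⟨g, hg.contDiff, ?_, fun x => hrange (Set.mem_range_self x), fun x => (hone x).1,
    fun x hx => ?_⟩
  · rwa [HasCompactSupport, tsupport, hsupp]
  · rw [← Function.notMem_support, hsupp]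
    exact fun hxW => hx (hWU (subset_closure hxW))

theorem le_of_forall_lintegral_contDiff_le {V : Type*} [NormedAddCommGroup V] [NormedSpace ℝ V]
    [FiniteDimensional ℝ V] [MeasurableSpace V] [BorelSpace V] {μ ν : Measure V}
    [IsFiniteMeasure μ] [ν.OuterRegular]
    (h : ∀ g : V → ℝ, ContDiff ℝ (⊤ : ℕ∞) g → HasCompactSupport g → 0 ≤ g →
      ∫⁻ x, ENNReal.ofReal (g x) ∂μ ≤ ∫⁻ x, ENNReal.ofReal (g x) ∂ν) : μ ≤ ν := by
  have hopen {L U : Set V} (hL : IsCompact L) (hU : IsOpen U) (hLU : L ⊆ U) : μ L ≤ ν U := by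
    obtain ⟨g, hg, hgc, hg01, hgL, hgU⟩ := exists_contDiff_eq_one_on_eq_zero_off hL hU hLU
    calc μ L = ∫⁻ x, L.indicator 1 x ∂μ := (lintegral_indicator_one hL.measurableSet).symm
      _ ≤ ∫⁻ x, ENNReal.ofReal (g x) ∂μ := lintegral_mono fun x => by
          by_cases hx : x ∈ L
          · simp [hx, hgL x hx]
          · simp [hx]
      _ ≤ ∫⁻ x, ENNReal.ofReal (g x) ∂ν := h g hg hgc fun x => (hg01 x).1
      _ ≤ ∫⁻ x, U.indicator 1 x ∂ν := lintegral_mono fun x => by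
          by_cases hx : x ∈ U
          · simpa [hx] using (hg01 x).2
          · simp [hgU x hx]
      _ = ν U := lintegral_indicator_one hU.measurableSet
  refine Measure.le_iff.2 fun A hA => ?_
  rw [hA.measure_eq_iSup_isCompact_of_ne_top (measure_ne_top μ A), A.measure_eq_iInf_isOpen ν]
  exact iSup₂_le fun L hLA => iSup_le fun hL => le_iInf₂ fun U hAU => le_iInf fun hU =>
    hopen hL hU (hLA.trans hAU)

theorem schwartz_eq_integral_fourier (φ : 𝓢(E d, ℂ)) (x : E d) :
    φ x = ∫ ξ, Real.fourierChar (inner ℝ ξ x) • 𝓕 φ ξ := by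
  rw [← Real.fourierInv_eq, ← SchwartzMap.fourierInv_coe, FourierTransform.fourierInv_fourier_eq]

namespace Cutoff

theorem sum_blockCLM_apply (χ : Cutoff d) (N : ℕ) (φ : 𝓢(E d, ℂ)) (x : E d) :
    ∑ n ∈ Finset.range (N + 1), χ.blockCLM n φ x =
      ∫ ξ, Real.fourierChar (inner ℝ ξ x) • ((χ.toFun (((2 : ℝ) ^ N)⁻¹ • ξ) : ℂ) * 𝓕 φ ξ) := by
  have hsymbol (ξ : E d) : 𝓕 (∑ n ∈ Finset.range (N + 1), χ.blockCLM n φ) ξ =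
      (χ.toFun (((2 : ℝ) ^ N)⁻¹ • ξ) : ℂ) * 𝓕 φ ξ := by
    have hsum : 𝓕 (∑ n ∈ Finset.range (N + 1), χ.blockCLM n φ) =
        ∑ n ∈ Finset.range (N + 1), 𝓕 (χ.blockCLM n φ) :=
      map_sum (FourierTransform.fourierCLM ℂ 𝓢(E d, ℂ)) _ _
    rw [hsum, sum_apply, ← χ.sum_symbol, Complex.ofReal_sum, Finset.sum_mul]
    simp only [fourier_blockCLM]
  rw [← sum_apply, schwartz_eq_integral_fourier]
  simp only [hsymbol]

theorem exists_norm_le (χ : Cutoff d) : ∃ M : ℝ, ∀ ξ, ‖(χ.toFun ξ : ℂ)‖ ≤ M :=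
  (χ.hasCompactSupport_symbol 0).exists_bound_of_continuous (χ.contDiff_symbol 0).continuous

theorem exists_norm_sum_blockCLM_le (χ : Cutoff d) (φ : 𝓢(E d, ℂ)) :
    ∃ B : ℝ, ∀ N x, ‖∑ n ∈ Finset.range (N + 1), χ.blockCLM n φ x‖ ≤ B := by
  obtain ⟨M, hM⟩ := χ.exists_norm_le
  refine ⟨∫ ξ, M * ‖𝓕 φ ξ‖, fun N x => ?_⟩
  rw [sum_blockCLM_apply]
  refine norm_integral_le_of_norm_le ((𝓕 φ).integrable.norm.const_mul M)
    (Eventually.of_forall fun ξ => ?_)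
  rw [Circle.norm_smul, norm_mul]
  gcongr
  exact hM _

theorem tendsto_sum_blockCLM_apply (χ : Cutoff d) (φ : 𝓢(E d, ℂ)) (x : E d) :
    Tendsto (fun N => ∑ n ∈ Finset.range (N + 1), χ.blockCLM n φ x) atTop (𝓝 (φ x)) := by
  obtain ⟨M, hM⟩ := χ.exists_norm_le
  have hcutoff (ξ : E d) :
      Tendsto (fun N : ℕ => (χ.toFun (((2 : ℝ) ^ N)⁻¹ • ξ) : ℂ)) atTop (𝓝 1) := by
    refine tendsto_const_nhds.congr' ?_
    filter_upwards [(tendsto_pow_atTop_atTop_of_one_lt one_lt_two).eventually_ge_atTop ‖ξ‖]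
      with N hN
    rw [χ.eq_one, Complex.ofReal_one]
    rw [norm_smul, norm_inv, Real.norm_of_nonneg (by positivity)]
    exact inv_mul_le_one_of_le₀ hN (by positivity)
  have hφ : φ x = ∫ ξ, Real.fourierChar (inner ℝ ξ x) • (1 * 𝓕 φ ξ) := by
    simpa only [one_mul] using schwartz_eq_integral_fourier φ x
  simp only [sum_blockCLM_apply]
  rw [hφ]
  refine tendsto_integral_of_dominated_convergence (fun ξ => M * ‖𝓕 φ ξ‖) (fun N => ?_)
    ((𝓕 φ).integrable.norm.const_mul M) (fun N => Eventually.of_forall fun ξ => ?_)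
    (Eventually.of_forall fun ξ => ((hcutoff ξ).mul_const _).const_smul _)
  · have hχ := χ.smooth.continuous
    have hF := (𝓕 φ).continuous
    exact Continuous.aestronglyMeasurable (by fun_prop)
  · rw [Circle.norm_smul, norm_mul]
    gcongr
    exact hM _

theorem tendsto_sum_integral_blockCLM (χ : Cutoff d) (μ : Measure (E d)) [IsFiniteMeasure μ]
    (φ : 𝓢(E d, ℂ)) :
    Tendsto (fun N => ∑ n ∈ Finset.range (N + 1),
      (isTranslationBounded_one μ).functional (χ.blockCLM n φ)) atTop
      (𝓝 ((isTranslationBounded_one μ).functional φ)) := by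
  obtain ⟨B, hB⟩ := χ.exists_norm_sum_blockCLM_le φ
  simp only [← map_sum]
  refine tendsto_integral_of_dominated_convergence (fun _ => B)
    (fun N => ((isTranslationBounded_one μ).integrable_mul _).aestronglyMeasurable)
    (integrable_const B) (fun N => Eventually.of_forall fun t => ?_)
    (Eventually.of_forall fun t => ?_)
  · simpa only [Pi.one_apply, Complex.ofReal_one, one_mul, sum_apply] using hB N t
  · simpa only [Pi.one_apply, Complex.ofReal_one, one_mul, sum_apply] using
      χ.tendsto_sum_blockCLM_apply φ t

theorem eLpNorm_one_weightedBlock_le (χ : Cutoff d) (n : ℕ) {ν : Measure (E d)} [SFinite ν]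
    {w : E d → ℝ} (hw : AEStronglyMeasurable w ν) :
    eLpNorm (χ.weightedBlock n ν w) 1 volume ≤ χ.mass * eLpNorm w 1 ν := by
  have hmeas : AEMeasurable (fun z : E d × E d => ‖w z.2‖ₑ * ‖χ.kernel n (z.1 - z.2)‖ₑ)
      (volume.prod ν) :=
    hw.enorm.comp_snd.mul
      ((χ.continuous_kernel n).comp (continuous_fst.sub continuous_snd)).enorm.aemeasurable
  rw [eLpNorm_one_eq_lintegral_enorm, eLpNorm_one_eq_lintegral_enorm]
  calc ∫⁻ x, ‖χ.weightedBlock n ν w x‖ₑ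
      ≤ ∫⁻ x, ∫⁻ t, ‖w t‖ₑ * ‖χ.kernel n (x - t)‖ₑ ∂ν := by
        refine lintegral_mono fun x => (enorm_integral_le_lintegral_enorm _).trans_eq ?_
        simp only [enorm_mul, enorm_complex_ofReal]
    _ = ∫⁻ t, (∫⁻ x, ‖w t‖ₑ * ‖χ.kernel n (x - t)‖ₑ) ∂ν := lintegral_lintegral_swap hmeas
    _ = ∫⁻ t, ‖w t‖ₑ * (∫⁻ x, ‖χ.kernel n x‖ₑ) ∂ν := lintegral_congr fun t => by
        rw [lintegral_const_mul' _ _ enorm_ne_top,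
          lintegral_sub_right_eq_self (fun x => ‖χ.kernel n x‖ₑ) t]
    _ ≤ ∫⁻ t, ‖w t‖ₑ * χ.mass ∂ν := by gcongr; exact χ.lintegral_enorm_kernel_le n
    _ = χ.mass * ∫⁻ t, ‖w t‖ₑ ∂ν := by rw [lintegral_mul_const' _ _ χ.mass_ne_top, mul_comm]

theorem lintegral_ofReal_le_of_contDiff (χ : Cutoff d) (μ : Measure (E d)) [IsFiniteMeasure μ]
    {g : E d → ℝ} (hg : ContDiff ℝ (⊤ : ℕ∞) g) (hgc : HasCompactSupport g) (hg0 : 0 ≤ g) :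
    ∫⁻ x, ENNReal.ofReal (g x) ∂μ ≤
      ∑' n, ∫⁻ x, ‖χ.weightedBlock n μ 1 x‖ₑ * ENNReal.ofReal (g x) := by
  have hμ := isTranslationBounded_one μ
  let u : 𝓢(E d, ℝ) := hgc.toSchwartzMap hg
  have hgint : Integrable g μ := hg.continuous.integrable_of_hasCompactSupport hgc
  have hleft : ∫⁻ x, ENNReal.ofReal (g x) ∂μ = ‖hμ.functional (schwartzOfReal u)‖ₑ := by
    rw [← ofReal_integral_eq_lintegral_ofReal hgint (Eventually.of_forall hg0),
      hμ.functional_schwartzOfReal, enorm_complex_ofReal]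
    simp only [Pi.one_apply, one_mul]
    exact (Real.enorm_of_nonneg (integral_nonneg hg0)).symm
  rw [hleft]
  refine le_of_tendsto' (χ.reflect.tendsto_sum_integral_blockCLM μ (schwartzOfReal u)).enorm
    fun N => ?_
  calc ‖∑ n ∈ Finset.range (N + 1), hμ.functional (χ.reflect.blockCLM n (schwartzOfReal u))‖ₑ
      ≤ ∑ n ∈ Finset.range (N + 1), ‖∫ x, (g x : ℂ) * χ.weightedBlock n μ 1 x‖ₑ := by
        simp only [← hμ.integral_mul_weightedBlock]
        exact enorm_sum_le _ _
    _ ≤ ∑ n ∈ Finset.range (N + 1), ∫⁻ x, ‖χ.weightedBlock n μ 1 x‖ₑ * ENNReal.ofReal (g x) := by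
        gcongr with n
        refine (enorm_integral_le_lintegral_enorm _).trans_eq (lintegral_congr fun x => ?_)
        rw [enorm_mul, enorm_complex_ofReal, Real.enorm_of_nonneg (hg0 x), mul_comm]
    _ ≤ _ := ENNReal.sum_le_tsum _

theorem absolutelyContinuous_of_tsum_ne_top (χ : Cutoff d) (μ : Measure (E d)) [IsFiniteMeasure μ]
    (h : ∑' n, eLpNorm (χ.weightedBlock n μ 1) 1 volume ≠ ∞) : μ ≪ volume := by
  let ρ : E d → ℝ≥0∞ := fun x => ∑' n, ‖χ.weightedBlock n μ 1 x‖ₑ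
  have hblock (n : ℕ) : AEMeasurable (‖χ.weightedBlock n μ 1 ·‖ₑ) volume :=
    ((isTranslationBounded_one μ).locallyIntegrable_weightedBlock χ n).aestronglyMeasurable.enorm
  have hρ : AEMeasurable ρ volume := AEMeasurable.tsum hblock
  have hfinite : ∫⁻ x, ρ x ≠ ∞ := by
    rw [lintegral_tsum hblock]
    simpa only [eLpNorm_one_eq_lintegral_enorm] using h
  have : IsFiniteMeasure (volume.withDensity ρ) := isFiniteMeasure_withDensity hfinite
  refine (le_of_forall_lintegral_contDiff_le fun g hg hgc hg0 => ?_).absolutelyContinuous.trans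
    (withDensity_absolutelyContinuous volume ρ)
  have hgm : AEMeasurable (fun x => ENNReal.ofReal (g x)) volume :=
    hg.continuous.measurable.ennreal_ofReal.aemeasurable
  refine (χ.lintegral_ofReal_le_of_contDiff μ hg hgc hg0).trans_eq ?_
  calc ∑' n, ∫⁻ x, ‖χ.weightedBlock n μ 1 x‖ₑ * ENNReal.ofReal (g x)
      = ∫⁻ x, ∑' n, ‖χ.weightedBlock n μ 1 x‖ₑ * ENNReal.ofReal (g x) :=
        (lintegral_tsum fun n => (hblock n).mul hgm).symm
    _ = ∫⁻ x, (ρ * fun x => ENNReal.ofReal (g x)) x :=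
        lintegral_congr fun x => ENNReal.tsum_mul_right
    _ = ∫⁻ x, ENNReal.ofReal (g x) ∂volume.withDensity ρ :=
        (lintegral_withDensity_eq_lintegral_mul₀ hρ hgm).symm

end Cutoff

end AbsoluteContinuity

/-! ### Laws of random variables -/

section Laws

variable {χ : Cutoff d} {m : ℕ} {s α : ℝ}

theorem zygmundNorm_neg (χ : Cutoff d) (α : ℝ) (f : E d → ℝ) :
    zygmundNorm χ α (-f) = zygmundNorm χ α f := by
  have hblock (n : ℕ) : χ.block n (-f) = -χ.block n f := by
    ext x
    simp only [Cutoff.block, convolution_def, Pi.neg_apply, ← integral_neg, map_neg, neg_apply]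
  simp only [zygmundNorm, besovNorm, hblock, eLpNorm_neg]

theorem toBoundedContinuousFunction_mem_zygmundSpace (χ : Cutoff d) (α : ℝ) (u : 𝓢(E d, ℝ)) :
    u.toBoundedContinuousFunction ∈ zygmundSpace χ α := by
  intro ε hε
  have hzero (n : ℕ) : χ.block n (fun x => u.toBoundedContinuousFunction x - u x) = 0 := by
    ext x
    simp [Cutoff.block, convolution_def]
  refine ⟨u, lt_of_le_of_lt (eLpNorm_top_count_le fun n => ?_) hε⟩
  rw [hzero, eLpNorm_zero, mul_zero]

theorem gainsOnDifferences_of_forall_mem_zygmundSpace {K : ℝ≥0∞} (μ : Measure (E d))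
    [IsFiniteMeasure μ]
    (h : ∀ φ ∈ zygmundSpace χ α, ∀ h : E d, ‖h‖ ≤ 1 →
      ENNReal.ofReal (∫ x, ((fwdDiff h)^[m] φ) x ∂μ) ≤ K * ‖h‖ₑ ^ s * zygmundNorm χ α φ) :
    GainsOnDifferences χ m s α ∞ K (isTranslationBounded_one μ).functional := by
  intro u y hy
  have hone_sided (v : 𝓢(E d, ℝ)) : ENNReal.ofReal (∫ x, ((schwartzDiff y)^[m] v) x ∂μ) ≤
      K * ‖y‖ₑ ^ s * zygmundNorm χ α v := by
    rw [coe_schwartzDiff_iterate]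
    exact h _ (toBoundedContinuousFunction_mem_zygmundSpace χ α v) y hy
  have hneg : ENNReal.ofReal (-∫ x, ((schwartzDiff y)^[m] u) x ∂μ) ≤
      K * ‖y‖ₑ ^ s * zygmundNorm χ α u := by
    have hu := hone_sided (-u)
    rw [iterate_map_neg] at hu
    simpa only [FunLike.coe_neg, Pi.neg_apply, integral_neg, zygmundNorm_neg] using hu
  calc ‖(isTranslationBounded_one μ).functional (schwartzOfReal ((schwartzDiff y)^[m] u))‖ₑ
      = ENNReal.ofReal |∫ x, ((schwartzDiff y)^[m] u) x ∂μ| := by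
        rw [IsTranslationBounded.functional_schwartzOfReal, enorm_complex_ofReal,
          Real.enorm_eq_ofReal_abs]
        simp only [Pi.one_apply, one_mul]
    _ ≤ K * ‖y‖ₑ ^ s * zygmundNorm χ α u := by
        rcases abs_choice (∫ x, ((schwartzDiff y)^[m] u) x ∂μ) with habs | habs <;> rw [habs]
        exacts [hone_sided u, hneg]
    _ ≤ K * ‖y‖ₑ ^ s * besovNorm χ α ∞ 1 u := by
        gcongr
        exact besovNorm_top_le_one χ α ∞ u

theorem absolutelyContinuous_of_gainsOnDifferences (hα : 0 < α) (hαs : α < s) {μ : Measure (E d)}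
    [IsFiniteMeasure μ] {K : ℝ≥0∞} (hK : K ≠ ∞)
    (hT : GainsOnDifferences χ m s α ∞ K (isTranslationBounded_one μ).functional) :
    μ ≪ volume := by
  obtain ⟨C, hC, hblocks⟩ :=
    exists_eLpNorm_weightedBlock_succ_le (p := 1) (q := ∞) χ m s hα ENNReal.one_ne_top
  have hzero : eLpNorm (χ.weightedBlock 0 μ 1) 1 volume ≠ ∞ :=
    ne_top_of_le_ne_top
      (ENNReal.mul_ne_top χ.mass_ne_top (memLp_const (1 : ℝ)).eLpNorm_ne_top)
      (χ.eLpNorm_one_weightedBlock_le 0 (isTranslationBounded_one μ).aestronglyMeasurable)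
  have hsucc : ∑' n, eLpNorm (χ.weightedBlock (n + 1) μ 1) 1 volume ≠ ∞ := by
    refine ne_top_of_le_ne_top ?_
      (ENNReal.tsum_le_tsum (hblocks μ 1 (isTranslationBounded_one μ) K hT))
    rw [ENNReal.tsum_mul_left]
    refine ENNReal.mul_ne_top (by finiteness)
      (ne_top_of_le_ne_top (tsum_two_rpow_neg_ne_top (sub_pos.2 hαs)) ?_)
    exact ENNReal.tsum_comp_le_tsum_of_injective (add_left_injective 1) _
  refine χ.absolutelyContinuous_of_tsum_ne_top μ ?_
  rw [tsum_eq_zero_add' ENNReal.summable]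
  exact ENNReal.add_ne_top.2 ⟨hzero, hsucc⟩

theorem functional_rnDeriv {μ : Measure (E d)} [IsFiniteMeasure μ] (hμ : μ ≪ volume)
    (hw : IsTranslationBounded volume fun x => (μ.rnDeriv volume x).toReal) :
    hw.functional = (isTranslationBounded_one μ).functional := by
  ext φ
  calc ∫ t, ((μ.rnDeriv volume t).toReal : ℂ) * φ t
      = ∫ t, φ t ∂μ := integral_rnDeriv_smul hμ
    _ = ∫ t, ((1 : ℝ) : ℂ) * φ t ∂μ := by simp only [Complex.ofReal_one, one_mul]

theorem exists_besovNorm_rnDeriv_le (χ : Cutoff d) (m : ℕ) (s : ℝ) (hα : 0 < α) :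
    ∃ C : ℝ, 0 < C ∧ ∀ (μ : Measure (E d)) [IsFiniteMeasure μ] (K : ℝ≥0∞), μ ≪ volume →
      GainsOnDifferences χ m s α ∞ K (isTranslationBounded_one μ).functional →
      besovNorm χ (s - α) 1 ∞ (fun x => (μ.rnDeriv volume x).toReal) ≤
        ENNReal.ofReal C * (μ Set.univ + K) := by
  obtain ⟨C, hC, hbesov⟩ :=
    exists_besovNorm_top_le (p := 1) (q := ∞) χ m s hα ENNReal.one_ne_top
  refine ⟨C, hC, fun μ _ K hμ hT => ?_⟩
  have hmem : MemLp (fun x => (μ.rnDeriv volume x).toReal) 1 volume :=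
    memLp_one_iff_integrable.2 Measure.integrable_toReal_rnDeriv
  have hw := isTranslationBounded_of_memLp (q := ∞) hmem
  have hnorm : eLpNorm (fun x => (μ.rnDeriv volume x).toReal) 1 volume = μ Set.univ := by
    rw [eLpNorm_one_eq_lintegral_enorm, ← Measure.lintegral_rnDeriv hμ]
    refine lintegral_congr_ae ?_
    filter_upwards [μ.rnDeriv_ne_top volume] with x hx
    rw [Real.enorm_of_nonneg ENNReal.toReal_nonneg, ENNReal.ofReal_toReal hx]
  exact hnorm ▸ hbesov _ hmem hw K (functional_rnDeriv hμ hw ▸ hT)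

theorem ofReal_mul_norm_rpow {F : Type*} [NormedAddCommGroup F] {K : ℝ} (hK : 0 ≤ K) (hs : 0 ≤ s)
    (h : F) : ENNReal.ofReal (K * ‖h‖ ^ s) = ENNReal.ofReal K * ‖h‖ₑ ^ s := by
  rw [ENNReal.ofReal_mul hK, ← ENNReal.ofReal_rpow_of_nonneg (norm_nonneg h) hs, ofReal_norm]

theorem continuous_fwdDiff_iterate {φ : E d → ℝ} (hφ : Continuous φ) (h : E d) (m : ℕ) :
    Continuous ((fwdDiff h)^[m] φ) :=
  Function.Iterate.rec Continuous hφ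
    (fun _ hψ => (hψ.comp (continuous_add_const h)).sub hψ) m

theorem gainsOnDifferences_map (hs : 0 ≤ s) {Ω : Type*} [MeasurableSpace Ω] {P : Measure Ω}
    [IsFiniteMeasure P] {X : Ω → E d} (hX : AEMeasurable X P) {K : ℝ} (hK : 0 ≤ K)
    (h : ∀ φ ∈ zygmundSpace χ α, ∀ h : E d, ‖h‖ ≤ 1 →
      ENNReal.ofReal (∫ ω, ((fwdDiff h)^[m] φ) (X ω) ∂P) ≤
        ENNReal.ofReal (K * ‖h‖ ^ s) * zygmundNorm χ α φ) :
    GainsOnDifferences χ m s α ∞ (ENNReal.ofReal K)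
      (isTranslationBounded_one (P.map X)).functional := by
  refine gainsOnDifferences_of_forall_mem_zygmundSpace _ fun φ hφ y hy => ?_
  rw [integral_map hX (continuous_fwdDiff_iterate φ.continuous y m).aestronglyMeasurable,
    ← ofReal_mul_norm_rpow hK hs]
  exact h φ hφ y hy

theorem gainsOnDifferences_of_integral (hs : 0 ≤ s) {p q : ℝ≥0∞} [p.HolderConjugate q]
    (hq : q ≠ ∞) {f : E d → ℝ} (hf : MemLp f p volume) (hw : IsTranslationBounded volume f)
    {K : ℝ} (hK : 0 ≤ K)
    (h : ∀ φ : E d → ℝ, ContDiff ℝ (⊤ : ℕ∞) φ → HasCompactSupport φ → ∀ h : E d, ‖h‖ ≤ 1 →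
      ENNReal.ofReal |∫ x, ((fwdDiff h)^[m] φ) x * f x| ≤
        ENNReal.ofReal (K * ‖h‖ ^ s) * triebelLizorkinNorm χ α q ∞ φ) :
    GainsOnDifferences χ m s α q (ENNReal.ofReal K) hw.functional := by
  have := ENNReal.HolderConjugate.symm (p := p) (q := q)
  refine gainsOnDifferences_of_forall_contDiff hs (ENNReal.HolderConjugate.one_le q p) hq
    ENNReal.ofReal_ne_top hw
    (hw.continuous_functional (ENNReal.HolderConjugate.one_le p q) hf) fun φ hφ hφc y hy => ?_
  rw [Real.enorm_eq_ofReal_abs, ← ofReal_mul_norm_rpow hK hs]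
  exact h φ hφ hφc y hy

end Laws

end Smoothing

end

open Smoothing in
theorem lemmal_general (d m : ℕ) (s α : ℝ) (hα : 0 < α) (hαs : α < s)
    (χ : Cutoff d) :
    (∃ C : ℝ, 0 < C ∧
      ∀ (Ω : Type*) [MeasurableSpace Ω] (P : Measure Ω) [IsProbabilityMeasure P]
        (X : Ω → E d) (_ : AEMeasurable X P) (K : ℝ) (_ : 0 < K),
        (∀ φ ∈ zygmundSpace χ α, ∀ h : E d, ‖h‖ ≤ 1 →
          ENNReal.ofReal (∫ ω, ((fwdDiff h)^[m] φ) (X ω) ∂P) ≤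
            ENNReal.ofReal (K * ‖h‖ ^ s) * zygmundNorm χ α φ) →
        HasPDF X P volume ∧
        MemBesov χ (s - α) 1 ∞ (fun x => (pdf X P volume x).toReal) ∧
        besovNorm χ (s - α) 1 ∞ (fun x => (pdf X P volume x).toReal) ≤
          ENNReal.ofReal (C * (1 + K))) ∧
    (∀ p q : ℝ, p.HolderConjugate q →
      ∃ C : ℝ, 0 < C ∧
        ∀ (f : E d → ℝ) (_ : MemLp f (ENNReal.ofReal p) volume) (K : ℝ) (_ : 0 < K),
          (∀ φ : E d → ℝ, ContDiff ℝ (⊤ : ℕ∞) φ → HasCompactSupport φ →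
            ∀ h : E d, ‖h‖ ≤ 1 →
            ENNReal.ofReal |∫ x, ((fwdDiff h)^[m] φ) x * f x| ≤
              ENNReal.ofReal (K * ‖h‖ ^ s) *
                triebelLizorkinNorm χ α (ENNReal.ofReal q) ∞ φ) →
          MemBesov χ (s - α) (ENNReal.ofReal p) ∞ f ∧
          besovNorm χ (s - α) (ENNReal.ofReal p) ∞ f ≤
            ENNReal.ofReal C *
              (eLpNorm f (ENNReal.ofReal p) volume + ENNReal.ofReal K)) := by
  have hs : 0 ≤ s := (hα.trans hαs).le
  refine ⟨?_, fun p q hpq => ?_⟩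
  · obtain ⟨C, hC, hbesov⟩ := exists_besovNorm_rnDeriv_le χ m s hα
    refine ⟨C, hC, fun Ω _ P _ X hX K hK hφ => ?_⟩
    have hgain := gainsOnDifferences_map hs hX hK.le hφ
    have hac := absolutelyContinuous_of_gainsOnDifferences hα hαs ENNReal.ofReal_ne_top hgain
    have hle : besovNorm χ (s - α) 1 ∞ (fun x => (pdf X P volume x).toReal) ≤
        ENNReal.ofReal (C * (1 + K)) := by
      have : IsProbabilityMeasure (P.map X) := Measure.isProbabilityMeasure_map hX
      refine (hbesov _ _ hac hgain).trans_eq ?_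
      rw [measure_univ, ENNReal.ofReal_mul hC.le, ENNReal.ofReal_add zero_le_one hK.le,
        ENNReal.ofReal_one]
    exact ⟨(hasPDF_iff_of_aemeasurable hX).2 ⟨inferInstance, hac⟩,
      ⟨memLp_one_iff_integrable.2 Measure.integrable_toReal_rnDeriv,
        hle.trans_lt ENNReal.ofReal_lt_top⟩, hle⟩
  · have : (ENNReal.ofReal p).HolderConjugate (ENNReal.ofReal q) := hpq.ennrealOfReal
    obtain ⟨C, hC, hbesov⟩ := exists_besovNorm_top_le (p := ENNReal.ofReal p)
      (q := ENNReal.ofReal q) χ m s hα ENNReal.ofReal_ne_top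
    refine ⟨C, hC, fun f hf K hK hφ => ?_⟩
    have hw := isTranslationBounded_of_memLp (q := ENNReal.ofReal q) hf
    have hgain := gainsOnDifferences_of_integral hs ENNReal.ofReal_ne_top hf hw hK.le hφ
    have hle := hbesov f hf hw _ hgain
    exact ⟨⟨hf, hle.trans_lt (ENNReal.mul_lt_top ENNReal.ofReal_lt_top
      (ENNReal.add_lt_top.2 ⟨hf.2, ENNReal.ofReal_lt_top⟩))⟩, hle⟩

theorem lemmal (d m : ℕ) (s α : ℝ) (hα : 0 < α) (hαs : α < s) (hsm : s < m)
    (χ : Smoothing.Cutoff d) :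
    -- laws of random variables
    (∃ C : ℝ, 0 < C ∧
      ∀ (Ω : Type*) [MeasurableSpace Ω] (P : Measure Ω) [IsProbabilityMeasure P]
        (X : Ω → Smoothing.E d) (_ : AEMeasurable X P) (K : ℝ) (_ : 0 < K),
        (∀ φ ∈ Smoothing.zygmundSpace χ α, ∀ h : Smoothing.E d, ‖h‖ ≤ 1 →
          ENNReal.ofReal (∫ ω, ((fwdDiff h)^[m] φ) (X ω) ∂P) ≤
            ENNReal.ofReal (K * ‖h‖ ^ s) * Smoothing.zygmundNorm χ α φ) →
        HasPDF X P volume ∧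
        Smoothing.MemBesov χ (s - α) 1 ∞ (fun x => (pdf X P volume x).toReal) ∧
        Smoothing.besovNorm χ (s - α) 1 ∞ (fun x => (pdf X P volume x).toReal) ≤
          ENNReal.ofReal (C * (1 + K))) ∧
    -- functions in `L^p`, `1 < p < ∞`
    (∀ p q : ℝ, p.HolderConjugate q →
      ∃ C : ℝ, 0 < C ∧
        ∀ (f : Smoothing.E d → ℝ) (_ : MemLp f (ENNReal.ofReal p) volume) (K : ℝ) (_ : 0 < K),
          (∀ φ : Smoothing.E d → ℝ, ContDiff ℝ (⊤ : ℕ∞) φ → HasCompactSupport φ →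
            ∀ h : Smoothing.E d, ‖h‖ ≤ 1 →
            ENNReal.ofReal |∫ x, ((fwdDiff h)^[m] φ) x * f x| ≤
              ENNReal.ofReal (K * ‖h‖ ^ s) *
                Smoothing.triebelLizorkinNorm χ α (ENNReal.ofReal q) ∞ φ) →
          Smoothing.MemBesov χ (s - α) (ENNReal.ofReal p) ∞ f ∧
          Smoothing.besovNorm χ (s - α) (ENNReal.ofReal p) ∞ f ≤
            ENNReal.ofReal C *
              (eLpNorm f (ENNReal.ofReal p) volume + ENNReal.ofReal K)) :=
  lemmal_general d m s α hα hαs χ
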